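/- Let $X$ be a real Banach lattice and let $X_{\mathbb C}=X\oplus iX$ be its complexification, a complex Banach lattice with modulus $|x+iy|=\sup_{\theta\in[0,2\pi]}(x\cos\theta+y\sin\theta)$ and norm $\|z\|=\||z|\|_X$. For a complex Banach space $E$, let $E_{\mathbb R}$ be $E$ regarded as a real Banach space, and let $\mathrm{FBL}[E_{\mathbb R}]$ be the closed sublattice generated by the evaluations $\delta_{E_{\mathbb R}}(z)\colon x^*\mapsto x^*(z)$, $z\in E$, in the Banach lattice (with the pointwise order) of all positively homogeneous functions $f\colon (E_{\mathbb R})^*\to\mathbb R$ with $$\sup\Big\{\sum_{j=1}^m|f(x_j^*)| : m\in\mathbb N,\ x_1^*,\dots,x_m^*\in (E_{\mathbb R})^*,\ \sup_{\|z\|\le 1}\sum_{j=1}^m|x_j^*(z)|\le 1\Big\}<\infty,$$ normed by this supremum. The free complex Banach lattice $\mathrm{FBL}_{\mathbb C}[E]$ is the complexification of $\mathrm{FBL}[E_{\mathbb R}]$ equipped with the (equivalent) norm $$\|f\|=\sup\Big\{\sum_{j=1}^m|f(\mathrm{Re}\,z_j^*)| : m\in\mathbb N,\ z_1^*,\dots,z_m^*\in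 E^*,\ \sup_{\|z\|\le 1}\sum_{j=1}^m|z_j^*(z)|\le 1\Big\},$$ together with the $\mathbb C$-linear embedding $\delta_E(z)=\delta_{E_{\mathbb R}}(z)-i\,\delta_{E_{\mathbb R}}(iz)$. For a bounded linear operator $T\colon E\to E$, let $\overline T\colon \mathrm{FBL}_{\mathbb C}[E]\to \mathrm{FBL}_{\mathbb C}[E]$ be the unique (complex) lattice homomorphism with $\overline T\circ\delta_E=\delta_E\circ T$; here a complex lattice homomorphism is the complexification of a bounded real lattice homomorphism. If $T\colon X_{\mathbb C}\to X_{\mathbb C}$ is a complex lattice homomorphism, then $$\sigma(T)\subset\sigma(\overline T),$$ where $\sigma(S)=\{\lambda\in\mathbb C : \lambda I-S \text{ is not invertible}\}$ denotes the spectrum of a bounded operator $S$. -/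

import Mathlib

set_option linter.unusedSectionVars false
set_option linter.unusedVariables false

open Filter Topology

open scoped ENNReal

/-- The complexification `X ⊕ iX` of `X`; the pair `⟨x, y⟩` stands for `x + iy`. -/
@[ext]
structure Cplx (X : Type*) where
  /-- real part -/
  re : X
  /-- imaginary part -/
  im : X

namespace Cplx

section Algebra

variable {X : Type*} [AddCommGroup X]

instance : Zero (Cplx X) := ⟨⟨0, 0⟩⟩
instance : Add (Cplx X) := ⟨fun z w => ⟨z.re + w.re, z.im + w.im⟩⟩
instance : Neg (Cplx X) := ⟨fun z => ⟨-z.re, -z.im⟩⟩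
instance : Sub (Cplx X) := ⟨fun z w => ⟨z.re - w.re, z.im - w.im⟩⟩

@[simp] theorem zero_re : (0 : Cplx X).re = 0 := rfl
@[simp] theorem zero_im : (0 : Cplx X).im = 0 := rfl
@[simp] theorem add_re (z w : Cplx X) : (z + w).re = z.re + w.re := rfl
@[simp] theorem add_im (z w : Cplx X) : (z + w).im = z.im + w.im := rfl
@[simp] theorem neg_re (z : Cplx X) : (-z).re = -z.re := rfl
@[simp] theorem neg_im (z : Cplx X) : (-z).im = -z.im := rfl
@[simp] theorem sub_re (z w : Cplx X) : (z - w).re = z.re - w.re := rfl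
@[simp] theorem sub_im (z w : Cplx X) : (z - w).im = z.im - w.im := rfl

instance : AddCommGroup (Cplx X) where
  add_assoc a b c := by ext <;> simp [add_assoc]
  zero_add a := by ext <;> simp
  add_zero a := by ext <;> simp
  nsmul := nsmulRec
  zsmul := zsmulRec
  neg_add_cancel a := by ext <;> simp
  add_comm a b := by ext <;> simp [add_comm]
  sub_eq_add_neg a b := by ext <;> simp [sub_eq_add_neg]

variable [Module ℝ X]

instance : SMul ℂ (Cplx X) :=
  ⟨fun c z => ⟨c.re • z.re - c.im • z.im, c.im • z.re + c.re • z.im⟩⟩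

@[simp] theorem smul_re (c : ℂ) (z : Cplx X) : (c • z).re = c.re • z.re - c.im • z.im := rfl
@[simp] theorem smul_im (c : ℂ) (z : Cplx X) : (c • z).im = c.im • z.re + c.re • z.im := rfl

instance : Module ℂ (Cplx X) where
  one_smul z := by ext <;> simp
  mul_smul c d z := by ext <;> simp <;> module
  smul_zero c := by ext <;> simp
  smul_add c z w := by ext <;> simp <;> module
  add_smul c d z := by ext <;> simp <;> module
  zero_smul z := by ext <;> simp

end Algebra

section Norm

variable {X : Type*} [NormedAddCommGroup X] [NormedSpace ℝ X] [Lattice X] [HasSolidNorm X]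
  [IsOrderedAddMonoid X] [IsOrderedModule ℝ X]

/-- The set `{x cos θ + y sin θ}` whose supremum is the modulus of `x + iy`. By periodicity it
does not matter whether `θ` ranges over `[0, 2π]` or over `ℝ`. -/
def rotations (z : Cplx X) : Set X :=
  Set.range fun θ : ℝ => Real.cos θ • z.re + Real.sin θ • z.im

theorem rot_le (z : Cplx X) (θ φ : ℝ) :
    Real.cos θ • z.re + Real.sin θ • z.im ≤
      (Real.cos φ • z.re + Real.sin φ • z.im) + |θ - φ| • (|z.re| + |z.im|) := by
  have key : ∀ (a b : ℝ) (x : X), |a - b| ≤ |θ - φ| → a • x ≤ b • x + |θ - φ| • |x| := by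
    intro a b x h
    have h1 : (a - b) • x ≤ |a - b| • |x| := by
      rcases le_total 0 (a - b) with h0 | h0
      · rw [abs_of_nonneg h0]
        exact smul_le_smul_of_nonneg_left (le_abs_self x) h0
      · rw [abs_of_nonpos h0]
        have : (a - b) • x = (-(a - b)) • (-x) := by module
        rw [this]
        exact smul_le_smul_of_nonneg_left (neg_le_abs x) (by linarith)
    have h2 : |a - b| • |x| ≤ |θ - φ| • |x| := smul_le_smul_of_nonneg_right h (abs_nonneg x)
    have h3 := h1.trans h2
    rw [sub_smul, sub_le_iff_le_add'] at h3
    exact h3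
  have hc := key (Real.cos θ) (Real.cos φ) z.re (by
    simpa [Real.dist_eq] using (Real.lipschitzWith_cos.dist_le_mul θ φ))
  have hs := key (Real.sin θ) (Real.sin φ) z.im (by
    simpa [Real.dist_eq] using (Real.lipschitzWith_sin.dist_le_mul θ φ))
  refine (add_le_add hc hs).trans (le_of_eq ?_)
  module

theorem exists_isLUB_rotations [CompleteSpace X] (z : Cplx X) : ∃ m, IsLUB (rotations z) m := by
  set f : ℝ → X := fun θ => Real.cos θ • z.re + Real.sin θ • z.im with hf
  set u : X := |z.re| + |z.im| with hu
  have hu0 : 0 ≤ u := add_nonneg (abs_nonneg _) (abs_nonneg _)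
  set s : ℕ → X := fun n => (Finset.range (n + 1)).sup' ⟨0, by simp⟩
    (fun k : ℕ => f (2 * Real.pi * ((k : ℝ) / ((n : ℝ) + 1)))) with hs
  set c : ℕ → ℝ := fun n => 2 * Real.pi * (1 / ((n : ℝ) + 1)) with hc
  have hc0 : ∀ n, 0 ≤ c n := fun n => by positivity
  have hclim : Tendsto c atTop (𝓝 0) := by
    simpa [hc] using tendsto_one_div_add_atTop_nhds_zero_nat.const_mul (2 * Real.pi)
  have hcanti : ∀ m n, m ≤ n → c n ≤ c m := by
    intro m n h
    have : (m : ℝ) ≤ n := by exact_mod_cast h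
    simp only [hc]
    gcongr
  have h1 : ∀ θ n, f θ ≤ s n + c n • u := by
    intro θ n
    set t := Int.fract (θ / (2 * Real.pi)) with ht
    have ht0 : 0 ≤ t := Int.fract_nonneg _
    have ht1 : t < 1 := Int.fract_lt_one _
    have hn : (0 : ℝ) < (n : ℝ) + 1 := by positivity
    set k := ⌊t * ((n : ℝ) + 1)⌋₊ with hk
    have hk1 : (k : ℝ) ≤ t * (n + 1) := Nat.floor_le (by positivity)
    have hk2 : t * (n + 1) < k + 1 := Nat.lt_floor_add_one _
    have hkn : k < n + 1 := by
      have : (k : ℝ) < (n : ℝ) + 1 := lt_of_le_of_lt hk1 (by nlinarith)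
      exact_mod_cast this
    have hft : f θ = f (2 * Real.pi * t) := by
      have : θ = 2 * Real.pi * t + ⌊θ / (2 * Real.pi)⌋ * (2 * Real.pi) := by
        have h := Int.floor_add_fract (θ / (2 * Real.pi))
        have h2 : θ = 2 * Real.pi * (θ / (2 * Real.pi)) := by field_simp
        rw [← ht] at h
        linear_combination h2 - 2 * Real.pi * h
      simp only [hf]
      rw [this, Real.cos_add_int_mul_two_pi, Real.sin_add_int_mul_two_pi]
    rw [hft]
    refine (rot_le z _ (2 * Real.pi * ((k : ℝ) / ((n : ℝ) + 1)))).trans ?_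
    refine add_le_add ?_ ?_
    · exact Finset.le_sup' (fun k : ℕ => f (2 * Real.pi * ((k : ℝ) / ((n : ℝ) + 1))))
        (Finset.mem_range.2 hkn)
    · refine smul_le_smul_of_nonneg_right ?_ hu0
      rw [← mul_sub, abs_mul, abs_of_pos (by positivity : (0 : ℝ) < 2 * Real.pi)]
      refine mul_le_mul_of_nonneg_left ?_ (by positivity)
      have hd : t - (k : ℝ) / ((n : ℝ) + 1) = (t * (n + 1) - k) / ((n : ℝ) + 1) := by field_simp
      rw [hd, abs_of_nonneg (div_nonneg (by linarith) hn.le)]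
      exact div_le_div_of_nonneg_right (by linarith) hn.le
  have h2 : ∀ m n, s m ≤ s n + c n • u := fun m n => Finset.sup'_le _ _ fun k _ => h1 _ n
  have hcau : CauchySeq s := by
    refine cauchySeq_of_le_tendsto_0 (fun n => c n * ‖u‖) ?_ (by simpa using hclim.mul_const ‖u‖)
    intro n m N hn hm
    rw [dist_eq_norm]
    have : |s n - s m| ≤ |c N • u| := by
      rw [abs_of_nonneg (smul_nonneg (hc0 N) hu0)]
      refine abs_le'.2 ⟨?_, ?_⟩
      · rw [sub_le_iff_le_add']
        exact (h2 n m).trans (add_le_add le_rfl (smul_le_smul_of_nonneg_right (hcanti _ _ hm) hu0))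
      · rw [neg_sub, sub_le_iff_le_add']
        exact (h2 m n).trans (add_le_add le_rfl (smul_le_smul_of_nonneg_right (hcanti _ _ hn) hu0))
    refine (norm_le_norm_of_abs_le_abs this).trans ?_
    rw [norm_smul, Real.norm_of_nonneg (hc0 N)]
  obtain ⟨m, hm⟩ := cauchySeq_tendsto_of_complete hcau
  refine ⟨m, ?_, ?_⟩
  · rintro _ ⟨θ, rfl⟩
    have hlim : Tendsto (fun n => s n + c n • u) atTop (𝓝 (m + (0 : ℝ) • u)) :=
      hm.add (hclim.smul_const u)
    rw [zero_smul, add_zero] at hlim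
    exact ge_of_tendsto' hlim (h1 θ)
  · intro b hb
    refine le_of_tendsto' hm fun n => Finset.sup'_le _ _ fun k _ => hb ⟨_, rfl⟩

variable [CompleteSpace X]

/-- The modulus `|x + iy| = sup_θ (x cos θ + y sin θ)`. -/
noncomputable def modulus (z : Cplx X) : X := (exists_isLUB_rotations z).choose

theorem isLUB_modulus (z : Cplx X) : IsLUB (rotations z) (modulus z) :=
  (exists_isLUB_rotations z).choose_spec

theorem rot_le_modulus (z : Cplx X) (θ : ℝ) :
    Real.cos θ • z.re + Real.sin θ • z.im ≤ modulus z := (isLUB_modulus z).1 ⟨θ, rfl⟩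

theorem modulus_le {z : Cplx X} {b : X}
    (h : ∀ θ : ℝ, Real.cos θ • z.re + Real.sin θ • z.im ≤ b) : modulus z ≤ b :=
  (isLUB_modulus z).2 (by rintro _ ⟨θ, rfl⟩; exact h θ)

theorem abs_re_le_modulus (z : Cplx X) : |z.re| ≤ modulus z :=
  abs_le'.2 ⟨by simpa using rot_le_modulus z 0, by simpa using rot_le_modulus z Real.pi⟩

theorem abs_im_le_modulus (z : Cplx X) : |z.im| ≤ modulus z :=
  abs_le'.2 ⟨by simpa using rot_le_modulus z (Real.pi / 2), by
    simpa [Real.cos_neg, Real.sin_neg] using rot_le_modulus z (-(Real.pi / 2))⟩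

theorem modulus_nonneg (z : Cplx X) : 0 ≤ modulus z :=
  (abs_nonneg _).trans (abs_re_le_modulus z)

theorem modulus_le_add (z : Cplx X) : modulus z ≤ |z.re| + |z.im| := by
  have key : ∀ (a : ℝ) (x : X), |a| ≤ 1 → a • x ≤ |x| := by
    intro a x h
    rcases le_total 0 a with h0 | h0
    · rw [abs_of_nonneg h0] at h
      calc a • x ≤ a • |x| := smul_le_smul_of_nonneg_left (le_abs_self x) h0
        _ ≤ (1 : ℝ) • |x| := smul_le_smul_of_nonneg_right h (abs_nonneg x)
        _ = |x| := one_smul _ _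
    · rw [abs_of_nonpos h0] at h
      calc a • x = (-a) • (-x) := by module
        _ ≤ (-a) • |x| := smul_le_smul_of_nonneg_left (neg_le_abs x) (by linarith)
        _ ≤ (1 : ℝ) • |x| := smul_le_smul_of_nonneg_right h (abs_nonneg x)
        _ = |x| := one_smul _ _
  exact modulus_le fun θ =>
    add_le_add (key _ _ (Real.abs_cos_le_one θ)) (key _ _ (Real.abs_sin_le_one θ))

theorem modulus_add_le (z w : Cplx X) : modulus (z + w) ≤ modulus z + modulus w :=
  modulus_le fun θ => by
    refine le_trans (le_of_eq ?_) (add_le_add (rot_le_modulus z θ) (rot_le_modulus w θ))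
    simp only [add_re, add_im]
    module

theorem modulus_smul_le (c : ℂ) (z : Cplx X) : modulus (c • z) ≤ ‖c‖ • modulus z :=
  modulus_le fun θ => by
    refine le_trans (le_of_eq ?_)
      (smul_le_smul_of_nonneg_left (rot_le_modulus z (θ - c.arg)) (norm_nonneg c))
    have h1 : c.re = ‖c‖ * Real.cos c.arg := (Complex.norm_mul_cos_arg c).symm
    have h2 : c.im = ‖c‖ * Real.sin c.arg := (Complex.norm_mul_sin_arg c).symm
    simp only [smul_re, smul_im]
    rw [Real.cos_sub, Real.sin_sub, h1, h2]
    module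

theorem modulus_neg_le (z : Cplx X) : modulus (-z) ≤ modulus z := by
  simpa using modulus_smul_le (-1) z

noncomputable instance : Norm (Cplx X) := ⟨fun z => ‖modulus z‖⟩

/-- The norm of a complex Banach lattice is the norm of the modulus. -/
theorem norm_def (z : Cplx X) : ‖z‖ = ‖modulus z‖ := rfl

theorem norm_le_norm_of_le {a b : X} (ha : 0 ≤ a) (h : a ≤ b) : ‖a‖ ≤ ‖b‖ :=
  norm_le_norm_of_abs_le_abs (by rwa [abs_of_nonneg ha, abs_of_nonneg (ha.trans h)])

theorem norm_re_le' (z : Cplx X) : ‖z.re‖ ≤ ‖modulus z‖ :=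
  norm_le_norm_of_abs_le_abs (by
    rw [abs_of_nonneg (modulus_nonneg z)]; exact abs_re_le_modulus z)

theorem norm_im_le' (z : Cplx X) : ‖z.im‖ ≤ ‖modulus z‖ :=
  norm_le_norm_of_abs_le_abs (by
    rw [abs_of_nonneg (modulus_nonneg z)]; exact abs_im_le_modulus z)

noncomputable instance : NormedAddCommGroup (Cplx X) :=
  AddGroupNorm.toNormedAddCommGroup
    { toFun := fun z => ‖modulus z‖
      map_zero' := by
        have : modulus (0 : Cplx X) = 0 :=
          le_antisymm (modulus_le fun θ => by simp) (modulus_nonneg _)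
        simp [this]
      add_le' := fun z w =>
        (norm_le_norm_of_le (modulus_nonneg _) (modulus_add_le z w)).trans (norm_add_le _ _)
      neg' := fun z => by
        rw [le_antisymm (modulus_neg_le z) (by simpa using modulus_neg_le (-z))]
      eq_zero_of_map_eq_zero' := fun z h => by
        have h1 := norm_re_le' z
        have h2 := norm_im_le' z
        rw [h] at h1 h2
        ext
        · simpa using h1
        · simpa using h2 }

noncomputable instance : NormedSpace ℂ (Cplx X) where
  norm_smul_le c z := by
    refine (norm_le_norm_of_le (modulus_nonneg _) (modulus_smul_le c z)).trans (le_of_eq ?_)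
    rw [norm_smul, norm_norm]
    rfl

theorem norm_re_le (z : Cplx X) : ‖z.re‖ ≤ ‖z‖ := norm_re_le' z

theorem norm_im_le (z : Cplx X) : ‖z.im‖ ≤ ‖z‖ := norm_im_le' z

theorem norm_le_add (z : Cplx X) : ‖z‖ ≤ ‖z.re‖ + ‖z.im‖ := by
  refine (norm_le_norm_of_le (modulus_nonneg _) (modulus_le_add z)).trans ?_
  refine (norm_add_le _ _).trans (le_of_eq ?_)
  rw [norm_abs_eq_norm, norm_abs_eq_norm]

instance : CompleteSpace (Cplx X) := by
  refine Metric.complete_of_cauchySeq_tendsto fun u hu => ?_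
  have key : ∀ p : Cplx X →+ X, (∀ z, ‖p z‖ ≤ ‖z‖) →
      ∃ a, Tendsto (fun n => p (u n)) atTop (𝓝 a) := by
    intro p hp
    have hl : LipschitzWith 1 p :=
      (AddMonoidHomClass.lipschitz_of_bound p 1 (by simpa using hp)).weaken (by simp)
    exact cauchySeq_tendsto_of_complete (hl.uniformContinuous.comp_cauchySeq hu)
  obtain ⟨a, ha⟩ := key ⟨⟨Cplx.re, rfl⟩, fun _ _ => rfl⟩ norm_re_le
  obtain ⟨b, hb⟩ := key ⟨⟨Cplx.im, rfl⟩, fun _ _ => rfl⟩ norm_im_le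
  have ha' := tendsto_iff_norm_sub_tendsto_zero.1 ha
  have hb' := tendsto_iff_norm_sub_tendsto_zero.1 hb
  have hab := ha'.add hb'
  rw [add_zero] at hab
  refine ⟨⟨a, b⟩, tendsto_iff_norm_sub_tendsto_zero.2 ?_⟩
  refine squeeze_zero (fun _ => norm_nonneg _) (fun n => ?_) hab
  have h := norm_le_add (u n - ⟨a, b⟩)
  rw [sub_re, sub_im] at h
  exact h

end Norm

section Operators

variable {X : Type*} [NormedAddCommGroup X] [NormedSpace ℝ X] [Lattice X] [HasSolidNorm X]
  [IsOrderedAddMonoid X] [IsOrderedModule ℝ X] [CompleteSpace X]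
variable {Y : Type*} [NormedAddCommGroup Y] [NormedSpace ℝ Y] [Lattice Y] [HasSolidNorm Y]
  [IsOrderedAddMonoid Y] [IsOrderedModule ℝ Y] [CompleteSpace Y]

/-- The complexification `x + iy ↦ S x + i S y` of a real operator `S`. -/
noncomputable def map (S : X →L[ℝ] Y) : Cplx X →L[ℂ] Cplx Y :=
  LinearMap.mkContinuous
    { toFun := fun z => ⟨S z.re, S z.im⟩
      map_add' := fun z w => by ext <;> simp
      map_smul' := fun c z => by ext <;> simp }
    (‖S‖ + ‖S‖) (fun z => by
      refine (norm_le_add _).trans ?_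
      rw [add_mul]
      exact add_le_add
        ((S.le_opNorm _).trans (mul_le_mul_of_nonneg_left (norm_re_le z) (norm_nonneg S)))
        ((S.le_opNorm _).trans (mul_le_mul_of_nonneg_left (norm_im_le z) (norm_nonneg S))))

@[simp] theorem map_apply (S : X →L[ℝ] Y) (z : Cplx X) : map S z = ⟨S z.re, S z.im⟩ := rfl

/-- A complex lattice homomorphism: the complexification of a real lattice homomorphism. -/
def IsLatticeHom (T : Cplx X →L[ℂ] Cplx Y) : Prop :=
  ∃ S : X →L[ℝ] Y, (∀ x y, S (x ⊔ y) = S x ⊔ S y) ∧ (∀ x y, S (x ⊓ y) = S x ⊓ S y) ∧ T = map S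

end Operators

end Cplx

namespace FreeBL

section TupleNorm

/-- The finite tuples of functionals `x₁*, …, xₙ*` with `∑ |xⱼ*(v)| ≤ 1` on the unit ball. -/
def weakUnit (𝕜 E : Type*) [RCLike 𝕜] [NormedAddCommGroup E] [NormedSpace 𝕜 E] :
    Set (Σ n : ℕ, Fin n → StrongDual 𝕜 E) :=
  {a | ∀ v : E, ‖v‖ ≤ 1 → ∑ j, ‖a.2 j v‖ ≤ 1}

variable {W : Type*}

/-- `sup ∑ |f(xⱼ)|`, the supremum over the tuples in `A`, with values in `[0, ∞]`. -/
noncomputable def tupleNorm (A : Set (Σ n : ℕ, Fin n → W)) (f : W → ℝ) : ℝ≥0∞ :=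
  ⨆ a ∈ A, ENNReal.ofReal (∑ j, |f (a.2 j)|)

variable {A : Set (Σ n : ℕ, Fin n → W)}

theorem le_tupleNorm {a : Σ n : ℕ, Fin n → W} (ha : a ∈ A) (f : W → ℝ) :
    ENNReal.ofReal (∑ j, |f (a.2 j)|) ≤ tupleNorm A f :=
  le_iSup₂ (f := fun a (_ : a ∈ A) => ENNReal.ofReal (∑ j, |f (a.2 j)|)) a ha

theorem tupleNorm_le {f : W → ℝ} {c : ℝ≥0∞}
    (h : ∀ a ∈ A, ENNReal.ofReal (∑ j, |f (a.2 j)|) ≤ c) : tupleNorm A f ≤ c :=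
  iSup₂_le h

theorem tupleNorm_mono {f g : W → ℝ} (h : ∀ w, |f w| ≤ |g w|) : tupleNorm A f ≤ tupleNorm A g :=
  tupleNorm_le fun _ ha => (ENNReal.ofReal_le_ofReal (Finset.sum_le_sum fun _ _ => h _)).trans
    (le_tupleNorm ha g)

theorem tupleNorm_add_of_le {f g h : W → ℝ} (H : ∀ w, |f w| ≤ |g w| + |h w|) :
    tupleNorm A f ≤ tupleNorm A g + tupleNorm A h :=
  tupleNorm_le fun a ha => by
    refine le_trans ?_ (add_le_add (le_tupleNorm ha g) (le_tupleNorm ha h))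
    rw [← ENNReal.ofReal_add (Finset.sum_nonneg fun _ _ => abs_nonneg _)
      (Finset.sum_nonneg fun _ _ => abs_nonneg _), ← Finset.sum_add_distrib]
    exact ENNReal.ofReal_le_ofReal (Finset.sum_le_sum fun _ _ => H _)

theorem tupleNorm_add_le (f g : W → ℝ) : tupleNorm A (f + g) ≤ tupleNorm A f + tupleNorm A g :=
  tupleNorm_add_of_le fun _ => abs_add_le _ _

theorem tupleNorm_smul_le (c : ℝ) (f : W → ℝ) :
    tupleNorm A (c • f) ≤ ENNReal.ofReal |c| * tupleNorm A f :=
  tupleNorm_le fun a ha => by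
    refine le_trans (le_of_eq ?_) (mul_le_mul_right (le_tupleNorm ha f) _)
    rw [← ENNReal.ofReal_mul (abs_nonneg c), Finset.mul_sum]
    simp [abs_mul]

theorem tupleNorm_zero : tupleNorm A (0 : W → ℝ) = 0 :=
  le_antisymm (tupleNorm_le fun a _ => by simp) bot_le

/-- Comparison of two such norms along a map of tuples that scales by `c`. -/
theorem tupleNorm_le_mul {V : Type*} {B : Set (Σ n : ℕ, Fin n → V)} {f : W → ℝ} {g : V → ℝ}
    {c : ℝ} (hc : 0 ≤ c) (p : W → V) 
    (hp : ∀ a ∈ A, (⟨a.1, fun j => p (a.2 j)⟩ : Σ n : ℕ, Fin n → V) ∈ B)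
    (h : ∀ w, |f w| ≤ c * |g (p w)|) : tupleNorm A f ≤ ENNReal.ofReal c * tupleNorm B g :=
  tupleNorm_le fun a ha => by
    refine le_trans ?_ (mul_le_mul_right (le_tupleNorm (hp a ha) g) _)
    rw [← ENNReal.ofReal_mul hc, Finset.mul_sum]
    exact ENNReal.ofReal_le_ofReal (Finset.sum_le_sum fun _ _ => h _)

end TupleNorm

section Real

variable (F : Type*) [NormedAddCommGroup F] [NormedSpace ℝ F]

/-- The space `H₁[F]` of positively homogeneous functions on `F*` of finite free norm. -/
def H1 : Submodule ℝ (StrongDual ℝ F → ℝ) where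
  carrier := {f | (∀ (c : ℝ) (φ : StrongDual ℝ F), 0 ≤ c → f (c • φ) = c * f φ) ∧
    tupleNorm (weakUnit ℝ F) f < ⊤}
  zero_mem' := ⟨fun _ _ _ => by simp, by rw [tupleNorm_zero]; exact ENNReal.zero_lt_top⟩
  add_mem' := fun {f g} hf hg =>
    ⟨fun c φ hc => by simp [hf.1 c φ hc, hg.1 c φ hc, mul_add],
      (tupleNorm_add_le f g).trans_lt (ENNReal.add_lt_top.2 ⟨hf.2, hg.2⟩)⟩
  smul_mem' := fun r f hf =>
    ⟨fun c φ hc => by simp only [Pi.smul_apply, smul_eq_mul, hf.1 c φ hc]; ring,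
      (tupleNorm_smul_le r f).trans_lt (ENNReal.mul_lt_top ENNReal.ofReal_lt_top hf.2)⟩

variable {F} in
/-- The evaluation function `δ_x` on `F*`. -/
def eval (x : F) : StrongDual ℝ F → ℝ := fun φ => φ x

/-- The vector sublattice of functions on `F*` generated by the evaluations `δ_x`, `x ∈ F`. -/
def generated : Submodule ℝ (StrongDual ℝ F → ℝ) :=
  sInf {M | (∀ x : F, eval x ∈ M) ∧ ∀ f ∈ M, ∀ g ∈ M, f ⊔ g ∈ M}

/-- The real free Banach lattice `FBL[F]` as a set of functions on `F*`: the closed sublattice of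
`H₁[F]` generated by the evaluations. -/
def FBL : Submodule ℝ (StrongDual ℝ F → ℝ) where
  carrier := {f | f ∈ H1 F ∧
    ∀ ε : ℝ≥0∞, 0 < ε → ∃ g ∈ generated F, tupleNorm (weakUnit ℝ F) (f - g) ≤ ε}
  zero_mem' := ⟨zero_mem _, fun ε hε => ⟨0, zero_mem _, by
    rw [sub_zero, tupleNorm_zero]; exact bot_le⟩⟩
  add_mem' := fun {f f'} hf hf' => ⟨add_mem hf.1 hf'.1, fun ε hε => by
    obtain ⟨g, hg, h⟩ := hf.2 (ε / 2) (ENNReal.half_pos hε.ne')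
    obtain ⟨g', hg', h'⟩ := hf'.2 (ε / 2) (ENNReal.half_pos hε.ne')
    refine ⟨g + g', add_mem hg hg', ?_⟩
    rw [add_sub_add_comm]
    exact (tupleNorm_add_le _ _).trans ((add_le_add h h').trans (ENNReal.add_halves ε).le)⟩
  smul_mem' := fun r f hf => ⟨(H1 F).smul_mem r hf.1, fun ε hε => by
    obtain ⟨g, hg, h⟩ := hf.2 (ε / ENNReal.ofReal |r|) (ENNReal.div_pos hε.ne' ENNReal.ofReal_ne_top)
    refine ⟨r • g, (generated F).smul_mem r hg, ?_⟩
    rw [← smul_sub]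
    exact (tupleNorm_smul_le r _).trans ((mul_le_mul_right h _).trans ENNReal.mul_div_le)⟩

variable {F}

theorem tupleNorm_eval_le (x : F) : tupleNorm (weakUnit ℝ F) (eval x) ≤ ENNReal.ofReal ‖x‖ := by
  refine tupleNorm_le fun a ha => ENNReal.ofReal_le_ofReal ?_
  rcases eq_or_ne x 0 with rfl | hx
  · simp [eval]
  have hx' : 0 < ‖x‖ := norm_pos_iff.2 hx
  have h := ha (‖x‖⁻¹ • x) (by rw [norm_smul, norm_inv, norm_norm, inv_mul_cancel₀ hx'.ne'])
  have h2 : ∑ j, ‖a.2 j (‖x‖⁻¹ • x)‖ = ‖x‖⁻¹ * ∑ j, |eval x (a.2 j)| := by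
    rw [Finset.mul_sum]
    simp [eval]
  rw [h2, inv_mul_le_iff₀ hx', mul_one] at h
  exact h

theorem eval_mem_generated (x : F) : eval x ∈ generated F :=
  Submodule.mem_sInf.2 fun _ hM => hM.1 x

theorem sup_mem_generated {f g : StrongDual ℝ F → ℝ} (hf : f ∈ generated F)
    (hg : g ∈ generated F) : f ⊔ g ∈ generated F :=
  Submodule.mem_sInf.2 fun M hM =>
    hM.2 f (Submodule.mem_sInf.1 hf M hM) g (Submodule.mem_sInf.1 hg M hM)

theorem eval_mem_FBL (x : F) : eval x ∈ FBL F :=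
  ⟨⟨fun c φ _ => by simp [eval], (tupleNorm_eval_le x).trans_lt ENNReal.ofReal_lt_top⟩,
    fun ε hε => ⟨eval x, eval_mem_generated x, by
      rw [sub_self, tupleNorm_zero]; exact bot_le⟩⟩

theorem sup_mem_FBL {f f' : StrongDual ℝ F → ℝ} (hf : f ∈ FBL F) (hf' : f' ∈ FBL F) :
    f ⊔ f' ∈ FBL F := by
  refine ⟨⟨fun c φ hc => ?_, ?_⟩, fun ε hε => ?_⟩
  · simp only [Pi.sup_apply, hf.1.1 c φ hc, hf'.1.1 c φ hc]
    exact (mul_max_of_nonneg _ _ hc).symm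
  · refine (tupleNorm_add_of_le (g := f) (h := f') fun w => ?_).trans_lt
      (ENNReal.add_lt_top.2 ⟨hf.1.2, hf'.1.2⟩)
    exact (abs_max_le_max_abs_abs).trans (max_le_add_of_nonneg (abs_nonneg _) (abs_nonneg _))
  · obtain ⟨g, hg, h⟩ := hf.2 (ε / 2) (ENNReal.half_pos hε.ne')
    obtain ⟨g', hg', h'⟩ := hf'.2 (ε / 2) (ENNReal.half_pos hε.ne')
    refine ⟨g ⊔ g', sup_mem_generated hg hg', ?_⟩
    refine (tupleNorm_add_of_le (g := f - g) (h := f' - g') fun w => ?_).trans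
      ((add_le_add h h').trans (ENNReal.add_halves ε).le)
    exact (abs_max_sub_max_le_max _ _ _ _).trans
      (max_le_add_of_nonneg (abs_nonneg _) (abs_nonneg _))

theorem inf_mem_FBL {f f' : StrongDual ℝ F → ℝ} (hf : f ∈ FBL F) (hf' : f' ∈ FBL F) :
    f ⊓ f' ∈ FBL F := by
  have h := neg_mem (sup_mem_FBL (neg_mem hf) (neg_mem hf'))
  rwa [neg_sup, neg_neg, neg_neg] at h

end Real

end FreeBL

/-- The real part of `FBL_ℂ[E]`: the set `FBL[E_ℝ]`, which is going to carry the norm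
`sup ∑ |f(Re zⱼ*)|`. -/
def FBLRe (E : Type*) [NormedAddCommGroup E] [NormedSpace ℂ E] : Type _ := FreeBL.FBL E

namespace FBLRe

open FreeBL

/-- An element of `FBL[E_ℝ]` as an element of the renormed copy. -/
def mk {E : Type*} [NormedAddCommGroup E] [NormedSpace ℂ E] (f : StrongDual ℝ E → ℝ)
    (hf : f ∈ FreeBL.FBL E) : FBLRe E := ⟨f, hf⟩

@[simp] theorem val_mk {E : Type*} [NormedAddCommGroup E] [NormedSpace ℂ E]
    (f : StrongDual ℝ E → ℝ) (hf : f ∈ FreeBL.FBL E) : (mk f hf).1 = f := rfl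

section Structure

variable {E : Type*} [NormedAddCommGroup E] [NormedSpace ℂ E]

/-- The real part of a complex functional. -/
noncomputable def rePart (ζ : StrongDual ℂ E) : StrongDual ℝ E :=
  Complex.reCLM.comp (ζ.restrictScalars ℝ)

@[simp] theorem rePart_apply (ζ : StrongDual ℂ E) (v : E) : rePart ζ v = (ζ v).re := rfl

/-- The norm `sup {∑ |f(Re zⱼ*)| : sup_{‖v‖ ≤ 1} ∑ |zⱼ*(v)| ≤ 1}`. -/
noncomputable def cNorm (f : StrongDual ℝ E → ℝ) : ℝ≥0∞ :=
  tupleNorm (weakUnit ℂ E) fun ζ => f (rePart ζ)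

/-- The complex functional `z ↦ φ(z) - i φ(iz)` with real part `φ`. -/
noncomputable def toComplex (φ : StrongDual ℝ E) : StrongDual ℂ E := φ.extendRCLike

theorem toComplex_apply (φ : StrongDual ℝ E) (v : E) :
    toComplex φ v = (φ v : ℂ) - Complex.I * (φ (Complex.I • v) : ℂ) :=
  StrongDual.extendRCLike_apply φ v

theorem rePart_toComplex (φ : StrongDual ℝ E) : rePart (toComplex φ) = φ := by
  ext v
  simp [toComplex_apply]

theorem cNorm_le (f : StrongDual ℝ E → ℝ) : cNorm f ≤ tupleNorm (weakUnit ℝ E) f := by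
  have := tupleNorm_le_mul (A := weakUnit ℂ E) (B := weakUnit ℝ E) (f := fun ζ => f (rePart ζ))
    (g := f) (c := 1) zero_le_one rePart
    (fun a ha v hv => (Finset.sum_le_sum fun j _ => by
      simpa using Complex.abs_re_le_norm (a.2 j v)).trans (ha v hv))
    (fun w => by simp)
  rwa [ENNReal.ofReal_one, one_mul] at this

theorem le_cNorm {f : StrongDual ℝ E → ℝ}
    (hf : ∀ (c : ℝ) (φ : StrongDual ℝ E), 0 ≤ c → f (c • φ) = c * f φ) :
    tupleNorm (weakUnit ℝ E) f ≤ 2 * cNorm f := by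
  have := tupleNorm_le_mul (A := weakUnit ℝ E) (B := weakUnit ℂ E) (f := f)
    (g := fun ζ => f (rePart ζ)) (c := 2) zero_le_two
    (fun φ => toComplex ((2⁻¹ : ℝ) • φ))
    (fun a ha v hv => by
      have h1 := ha v hv
      have h2 := ha (Complex.I • v) (by simpa [norm_smul] using hv)
      have h3 : ∀ j, ‖toComplex ((2⁻¹ : ℝ) • a.2 j) v‖ ≤
          2⁻¹ * (‖a.2 j v‖ + ‖a.2 j (Complex.I • v)‖) := by
        intro j
        rw [toComplex_apply]
        refine (norm_sub_le _ _).trans (le_of_eq ?_)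
        simp
        ring
      refine (Finset.sum_le_sum fun j _ => h3 j).trans ?_
      rw [← Finset.mul_sum, Finset.sum_add_distrib]
      linarith)
    (fun w => by
      rw [rePart_toComplex, hf _ _ (by norm_num), abs_mul, abs_of_pos (by norm_num : (0 : ℝ) < 2⁻¹)]
      exact le_of_eq (by ring))
  have h2 : ENNReal.ofReal 2 = 2 := by simp
  rwa [h2] at this

theorem cNorm_lt_top (f : FBLRe E) : cNorm f.1 < ⊤ := (cNorm_le f.1).trans_lt f.2.1.2

noncomputable instance : AddCommGroup (FBLRe E) := inferInstanceAs (AddCommGroup (FreeBL.FBL E))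

noncomputable instance : Module ℝ (FBLRe E) := inferInstanceAs (Module ℝ (FreeBL.FBL E))

@[ext] theorem ext {f g : FBLRe E} (h : ∀ φ, f.1 φ = g.1 φ) : f = g := Subtype.ext (funext h)

@[simp] theorem val_zero : (0 : FBLRe E).1 = 0 := rfl
@[simp] theorem val_add (f g : FBLRe E) : (f + g).1 = f.1 + g.1 := rfl
@[simp] theorem val_neg (f : FBLRe E) : (-f).1 = -f.1 := rfl
@[simp] theorem val_sub (f g : FBLRe E) : (f - g).1 = f.1 - g.1 := rfl
@[simp] theorem val_smul (c : ℝ) (f : FBLRe E) : (c • f).1 = c • f.1 := rfl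

/-- The order and the lattice operations are pointwise. -/
noncomputable instance : Lattice (FBLRe E) where
  le f g := f.1 ≤ g.1
  le_refl f := le_refl f.1
  le_trans _ _ _ h h' := le_trans (α := StrongDual ℝ E → ℝ) h h'
  le_antisymm _ _ h h' := Subtype.ext (le_antisymm h h')
  sup f g := ⟨f.1 ⊔ g.1, sup_mem_FBL f.2 g.2⟩
  inf f g := ⟨f.1 ⊓ g.1, inf_mem_FBL f.2 g.2⟩
  le_sup_left f g := le_sup_left (a := f.1) (b := g.1)
  le_sup_right f g := le_sup_right (a := f.1) (b := g.1)
  sup_le _ _ _ h h' := sup_le (α := StrongDual ℝ E → ℝ) h h'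
  inf_le_left f g := inf_le_left (a := f.1) (b := g.1)
  inf_le_right f g := inf_le_right (a := f.1) (b := g.1)
  le_inf _ _ _ h h' := le_inf (α := StrongDual ℝ E → ℝ) h h'

theorem le_def {f g : FBLRe E} : f ≤ g ↔ ∀ φ, f.1 φ ≤ g.1 φ := Iff.rfl
@[simp] theorem val_sup (f g : FBLRe E) : (f ⊔ g).1 = f.1 ⊔ g.1 := rfl
@[simp] theorem val_inf (f g : FBLRe E) : (f ⊓ g).1 = f.1 ⊓ g.1 := rfl
theorem val_abs (f : FBLRe E) (φ : StrongDual ℝ E) : (|f|).1 φ = |f.1 φ| := rfl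

instance : IsOrderedAddMonoid (FBLRe E) where
  add_le_add_left f g h k := fun φ => by
    simpa using h φ

instance : IsOrderedModule ℝ (FBLRe E) where
  smul_le_smul_of_nonneg_left c hc f g h := fun φ => mul_le_mul_of_nonneg_left (h φ) hc
  smul_le_smul_of_nonneg_right f hf c d h := fun φ => mul_le_mul_of_nonneg_right h (hf φ)

/-- Evaluation at a point is bounded for the norm `cNorm`. -/
theorem exists_abs_le (φ : StrongDual ℝ E) : ∃ c : ℝ, 0 ≤ c ∧ ∀ f ∈ FreeBL.FBL E,
    |f φ| ≤ c * (cNorm f).toReal := by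
  set c : ℝ := ‖toComplex φ‖ + 1 with hc
  have hc0 : 0 < c := by positivity
  refine ⟨c, hc0.le, fun f hf => ?_⟩
  have hmem : (⟨1, fun _ => toComplex (c⁻¹ • φ)⟩ : Σ n : ℕ, Fin n → StrongDual ℂ E) ∈
      weakUnit ℂ E := by
    intro v hv
    have h1 : toComplex (c⁻¹ • φ) v = (c⁻¹ : ℂ) * toComplex φ v := by
      rw [toComplex_apply, toComplex_apply]
      simp
      ring
    have h2 : ‖toComplex φ v‖ ≤ c := by
      refine ((toComplex φ).le_opNorm v).trans ?_
      nlinarith [norm_nonneg (toComplex φ), norm_nonneg v]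
    simp only [Finset.univ_unique, Finset.sum_const, Finset.card_singleton, one_smul, h1]
    rw [norm_mul, norm_inv, Complex.norm_real, Real.norm_of_nonneg hc0.le,
      inv_mul_le_iff₀ hc0, mul_one]
    exact h2
  have h := le_tupleNorm hmem (fun ζ => f (rePart ζ))
  have h3 : |f (c⁻¹ • φ)| ≤ (cNorm f).toReal := by
    have hfin : cNorm f ≠ ⊤ := (cNorm_lt_top ⟨f, hf⟩).ne
    have := (ENNReal.ofReal_le_iff_le_toReal hfin).1 h
    simpa [rePart_toComplex] using this
  rw [hf.1.1 _ _ (inv_nonneg.2 hc0.le), abs_mul, abs_inv, abs_of_pos hc0,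
    inv_mul_le_iff₀ hc0] at h3
  exact h3

noncomputable instance : Norm (FBLRe E) := ⟨fun f => (cNorm f.1).toReal⟩

theorem norm_def (f : FBLRe E) : ‖f‖ = (cNorm f.1).toReal := rfl

theorem cNorm_neg (f : StrongDual ℝ E → ℝ) : cNorm (-f) = cNorm f :=
  le_antisymm (tupleNorm_mono fun _ => by simp) (tupleNorm_mono fun _ => by simp)

noncomputable instance : NormedAddCommGroup (FBLRe E) :=
  AddGroupNorm.toNormedAddCommGroup
    { toFun := fun f => (cNorm f.1).toReal
      map_zero' := by
        have : cNorm (0 : StrongDual ℝ E → ℝ) = 0 := tupleNorm_zero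
        simp [this]
      add_le' := fun f g => by
        rw [← ENNReal.toReal_add (cNorm_lt_top f).ne (cNorm_lt_top g).ne]
        exact ENNReal.toReal_mono (ENNReal.add_lt_top.2 ⟨cNorm_lt_top f, cNorm_lt_top g⟩).ne
          (tupleNorm_add_le _ _)
      neg' := fun f => by rw [val_neg, cNorm_neg]
      eq_zero_of_map_eq_zero' := fun f h => by
        ext φ
        obtain ⟨c, _, hc⟩ := exists_abs_le φ
        have := hc f.1 f.2
        rw [h, mul_zero] at this
        simpa using this }

noncomputable instance : NormedSpace ℝ (FBLRe E) where
  norm_smul_le c f := by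
    rw [norm_def, norm_def, Real.norm_eq_abs, ← ENNReal.toReal_ofReal (abs_nonneg c),
      ← ENNReal.toReal_mul]
    exact ENNReal.toReal_mono (ENNReal.mul_lt_top ENNReal.ofReal_lt_top (cNorm_lt_top f)).ne
      (tupleNorm_smul_le c _)

instance : HasSolidNorm (FBLRe E) where
  solid f g h := ENNReal.toReal_mono (cNorm_lt_top g).ne (tupleNorm_mono fun ζ => h (rePart ζ))

instance : CompleteSpace (FBLRe E) := by
  refine Metric.complete_of_cauchySeq_tendsto fun u hu => ?_
  have hpt : ∀ φ : StrongDual ℝ E, ∃ t, Tendsto (fun n => (u n).1 φ) atTop (𝓝 t) := by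
    intro φ
    obtain ⟨c, hc0, hc⟩ := exists_abs_le φ
    refine cauchySeq_tendsto_of_complete ?_
    rw [Metric.cauchySeq_iff] at hu ⊢
    intro ε hε
    obtain ⟨N, hN⟩ := hu (ε / (c + 1)) (by positivity)
    refine ⟨N, fun m hm n hn => ?_⟩
    have h1 := hN m hm n hn
    rw [dist_eq_norm, lt_div_iff₀ (by positivity)] at h1
    have h2 : |(u m).1 φ - (u n).1 φ| ≤ c * ‖u m - u n‖ := hc _ (u m - u n).2
    rw [Real.dist_eq]
    nlinarith [norm_nonneg (u m - u n)]
  choose f hf using hpt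
  have hhom : ∀ (c : ℝ) (φ : StrongDual ℝ E), 0 ≤ c → f (c • φ) = c * f φ := by
    intro c φ hc
    refine tendsto_nhds_unique (hf (c • φ)) ?_
    have : (fun n => (u n).1 (c • φ)) = fun n => c * (u n).1 φ :=
      funext fun n => (u n).2.1.1 c φ hc
    rw [this]
    exact (hf φ).const_mul c
  have hlim : ∀ ε : ℝ, 0 < ε → ∃ N, ∀ n ≥ N, cNorm (f - (u n).1) ≤ ENNReal.ofReal ε := by
    intro ε hε
    obtain ⟨N, hN⟩ := Metric.cauchySeq_iff.1 hu ε hε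
    refine ⟨N, fun n hn => tupleNorm_le fun a ha => ENNReal.ofReal_le_ofReal ?_⟩
    have ht : Tendsto (fun m => ∑ j, |((u m).1 - (u n).1) (rePart (a.2 j))|) atTop
        (𝓝 (∑ j, |(f - (u n).1) (rePart (a.2 j))|)) :=
      tendsto_finsetSum _ fun j _ => ((hf _).sub_const _).abs
    refine le_of_tendsto ht (eventually_atTop.2 ⟨N, fun m hm => ?_⟩)
    have h1 := hN m hm n hn
    rw [dist_eq_norm] at h1
    have h2 := le_tupleNorm ha (fun ζ => ((u m).1 - (u n).1) (rePart ζ))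
    exact ((ENNReal.ofReal_le_iff_le_toReal (cNorm_lt_top (u m - u n)).ne).1 h2).trans h1.le
  have hreal : ∀ n, tupleNorm (weakUnit ℝ E) (f - (u n).1) ≤ 2 * cNorm (f - (u n).1) := fun n =>
    le_cNorm fun c φ hc => by
      simp only [Pi.sub_apply, hhom c φ hc, (u n).2.1.1 c φ hc]
      ring
  have hmem : f ∈ FreeBL.FBL E := by
    refine ⟨⟨hhom, ?_⟩, fun ε hε => ?_⟩
    · obtain ⟨N, hN⟩ := hlim 1 one_pos
      have h1 : tupleNorm (weakUnit ℝ E) (f - (u N).1) < ⊤ :=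
        ((hreal N).trans (mul_le_mul_right (hN N le_rfl) 2)).trans_lt
          (ENNReal.mul_lt_top (by simp) ENNReal.ofReal_lt_top)
      have h2 := tupleNorm_add_le (A := weakUnit ℝ E) (f - (u N).1) (u N).1
      rw [sub_add_cancel] at h2
      exact h2.trans_lt (ENNReal.add_lt_top.2 ⟨h1, (u N).2.1.2⟩)
    · obtain ⟨δ, hδ0, hδ⟩ : ∃ δ : ℝ, 0 < δ ∧ 2 * ENNReal.ofReal δ ≤ ε / 2 := by
        rcases eq_or_ne ε ⊤ with rfl | hε'
        · exact ⟨1, one_pos, by simp [ENNReal.top_div]⟩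
        · refine ⟨ε.toReal / 4, by have := ENNReal.toReal_pos hε.ne' hε'; positivity, ?_⟩
          rw [ENNReal.ofReal_div_of_pos (by norm_num), ENNReal.ofReal_toReal hε']
          have : (2 : ℝ≥0∞) * (ε / ENNReal.ofReal 4) = ε / 2 := by
            have h4 : ENNReal.ofReal 4 = 2 * 2 := by
              rw [show (4 : ℝ) = 2 * 2 by norm_num, ENNReal.ofReal_mul (by norm_num)]
              simp
            rw [h4, ← mul_div_assoc]
            exact ENNReal.mul_div_mul_left _ _ (by simp) (by simp)
          rw [this]
      obtain ⟨N, hN⟩ := hlim δ hδ0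
      obtain ⟨g, hg, h⟩ := (u N).2.2 (ε / 2) (ENNReal.half_pos hε.ne')
      refine ⟨g, hg, ?_⟩
      have h1 := tupleNorm_add_le (A := weakUnit ℝ E) (f - (u N).1) ((u N).1 - g)
      rw [sub_add_sub_cancel] at h1
      refine h1.trans ((add_le_add (((hreal N).trans (mul_le_mul_right (hN N le_rfl) 2)).trans hδ)
        h).trans (ENNReal.add_halves ε).le)
  let F : FBLRe E := mk f hmem
  refine ⟨F, Metric.tendsto_atTop.2 ?_⟩
  intro ε hε
  obtain ⟨N, hN⟩ := hlim (ε / 2) (by positivity)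
  refine ⟨N, fun n hn => ?_⟩
  rw [dist_comm, dist_eq_norm]
  have h1 : ‖F - u n‖ ≤ ε / 2 := by
    have h2 := ENNReal.toReal_mono ENNReal.ofReal_ne_top (hN n hn)
    rw [ENNReal.toReal_ofReal (by positivity)] at h2
    exact h2
  linarith

/-- The real evaluation map `δ_{E_ℝ}`. -/
noncomputable def deltaRe (x : E) : FBLRe E := mk (eval x) (eval_mem_FBL x)

@[simp] theorem deltaRe_apply (x : E) (φ : StrongDual ℝ E) : (deltaRe x).1 φ = φ x := rfl

theorem norm_deltaRe_le (x : E) : ‖deltaRe x‖ ≤ ‖x‖ := by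
  have h := ENNReal.toReal_mono ENNReal.ofReal_ne_top ((cNorm_le _).trans (tupleNorm_eval_le x))
  rwa [ENNReal.toReal_ofReal (norm_nonneg x)] at h

end Structure

section Functorial

variable {E : Type*} [NormedAddCommGroup E] [NormedSpace ℂ E]
variable {G : Type*} [NormedAddCommGroup G] [NormedSpace ℂ G]

theorem generated_le : generated E ≤ FreeBL.FBL E :=
  sInf_le ⟨eval_mem_FBL, fun _ hf _ hg => sup_mem_FBL hf hg⟩

theorem hom_of_mem {f : StrongDual ℝ E → ℝ} (hf : f ∈ FreeBL.FBL E) (c : ℝ) (φ : StrongDual ℝ E)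
    (hc : 0 ≤ c) : f (c • φ) = c * f φ := hf.1.1 c φ hc

/-- Composition with the adjoint of `T`, on functions. -/
noncomputable def compFun (T : E →L[ℂ] G) : (StrongDual ℝ E → ℝ) →ₗ[ℝ] (StrongDual ℝ G → ℝ) :=
  LinearMap.funLeft ℝ ℝ fun φ => φ.comp (T.restrictScalars ℝ)

@[simp] theorem compFun_apply (T : E →L[ℂ] G) (f : StrongDual ℝ E → ℝ) (φ : StrongDual ℝ G) :
    compFun T f φ = f (φ.comp (T.restrictScalars ℝ)) := rfl

theorem norm_inv_smul_le (T : E →L[ℂ] G) {v : E} (hv : ‖v‖ ≤ 1) :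
    ‖(‖T‖ + 1)⁻¹ • T v‖ ≤ 1 := by
  have hc : 0 < ‖T‖ + 1 := by positivity
  rw [norm_smul, norm_inv, Real.norm_of_nonneg hc.le, inv_mul_le_iff₀ hc, mul_one]
  refine (T.le_opNorm v).trans ?_
  nlinarith [norm_nonneg T, norm_nonneg v]

theorem tupleNorm_compFun_le (T : E →L[ℂ] G) {f : StrongDual ℝ E → ℝ}
    (hf : ∀ (c : ℝ) (φ : StrongDual ℝ E), 0 ≤ c → f (c • φ) = c * f φ) :
    tupleNorm (weakUnit ℝ G) (compFun T f) ≤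
      ENNReal.ofReal (‖T‖ + 1) * tupleNorm (weakUnit ℝ E) f := by
  have hc : 0 < ‖T‖ + 1 := by positivity
  refine tupleNorm_le_mul hc.le (fun φ => (‖T‖ + 1)⁻¹ • φ.comp (T.restrictScalars ℝ)) ?_ ?_
  · intro a ha v hv
    refine le_trans (le_of_eq ?_) (ha _ (norm_inv_smul_le T hv))
    simp
  · intro φ
    rw [hf _ _ (inv_nonneg.2 hc.le), abs_mul, abs_inv, abs_of_pos hc, mul_inv_cancel_left₀ hc.ne']
    exact le_rfl

theorem cNorm_compFun_le (T : E →L[ℂ] G) {f : StrongDual ℝ E → ℝ}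
    (hf : ∀ (c : ℝ) (φ : StrongDual ℝ E), 0 ≤ c → f (c • φ) = c * f φ) :
    cNorm (compFun T f) ≤ ENNReal.ofReal (‖T‖ + 1) * cNorm f := by
  have hc : 0 < ‖T‖ + 1 := by positivity
  have hre : ∀ (r : ℝ) (v : G) (ζ : StrongDual ℂ G), ζ (r • v) = r • ζ v := fun r v ζ =>
    (ζ.restrictScalars ℝ).map_smul r v
  refine tupleNorm_le_mul hc.le (fun ζ => ((‖T‖ + 1 : ℝ)⁻¹ : ℂ) • ζ.comp T) ?_ ?_
  · intro a ha v hv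
    refine le_trans (le_of_eq ?_) (ha _ (norm_inv_smul_le T hv))
    refine Finset.sum_congr rfl fun j _ => ?_
    rw [hre, ← Complex.ofReal_inv]
    simp
  · intro ζ
    have h1 : rePart (((‖T‖ + 1 : ℝ)⁻¹ : ℂ) • ζ.comp T) =
        (‖T‖ + 1)⁻¹ • (rePart ζ).comp (T.restrictScalars ℝ) := by
      ext v
      rw [← Complex.ofReal_inv]
      simp only [rePart_apply, _root_.smul_apply, smul_eq_mul, Complex.re_ofReal_mul]
      rfl
    rw [h1, hf _ _ (inv_nonneg.2 hc.le), abs_mul, abs_inv, abs_of_pos hc,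
      mul_inv_cancel_left₀ hc.ne']
    exact le_rfl

theorem compFun_mem_generated (T : E →L[ℂ] G) {f : StrongDual ℝ E → ℝ} (hf : f ∈ generated E) :
    compFun T f ∈ generated G := by
  have : generated E ≤ (generated G).comap (compFun T) :=
    sInf_le ⟨fun x => eval_mem_generated (T x), fun _ hf _ hg => sup_mem_generated hf hg⟩
  exact this hf

theorem compFun_mem_FBL (T : E →L[ℂ] G) {f : StrongDual ℝ E → ℝ} (hf : f ∈ FreeBL.FBL E) :
    compFun T f ∈ FreeBL.FBL G := by
  have hc : 0 < ‖T‖ + 1 := by positivity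
  refine ⟨⟨fun c φ hc => ?_, ?_⟩, fun ε hε => ?_⟩
  · simp only [compFun_apply, ContinuousLinearMap.smul_comp, hf.1.1 c _ hc]
  · exact (tupleNorm_compFun_le T hf.1.1).trans_lt
      (ENNReal.mul_lt_top ENNReal.ofReal_lt_top hf.1.2)
  · obtain ⟨g, hg, h⟩ := hf.2 (ε / ENNReal.ofReal (‖T‖ + 1))
      (ENNReal.div_pos hε.ne' ENNReal.ofReal_ne_top)
    refine ⟨compFun T g, compFun_mem_generated T hg, ?_⟩
    rw [← map_sub]
    exact (tupleNorm_compFun_le T (hom_of_mem (sub_mem hf (generated_le hg)))).trans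
      ((mul_le_mul_right h _).trans ENNReal.mul_div_le)

/-- The real lattice homomorphism `f ↦ f ∘ T*`. -/
noncomputable def compRe (T : E →L[ℂ] G) : FBLRe E →L[ℝ] FBLRe G :=
  LinearMap.mkContinuous
    { toFun := fun f => mk (compFun T f.1) (compFun_mem_FBL T f.2)
      map_add' := fun _ _ => rfl
      map_smul' := fun _ _ => rfl }
    (‖T‖ + 1) (fun f => by
      have h := ENNReal.toReal_mono
        (ENNReal.mul_lt_top ENNReal.ofReal_lt_top (cNorm_lt_top f)).ne
        (cNorm_compFun_le T f.2.1.1)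
      rw [ENNReal.toReal_mul, ENNReal.toReal_ofReal (by positivity)] at h
      exact h)

/-- Real lattice homomorphisms on `FBL[E_ℝ]` are determined by their values on evaluations. -/
theorem hom_ext {S S' : FBLRe E →L[ℝ] FBLRe G} (hS : ∀ f g, S (f ⊔ g) = S f ⊔ S g)
    (hS' : ∀ f g, S' (f ⊔ g) = S' f ⊔ S' g) (h : ∀ x, S (deltaRe x) = S' (deltaRe x)) :
    S = S' := by
  have hgen : ∀ f (hf : f ∈ generated E), ∃ hf' : f ∈ FreeBL.FBL E,
      S (mk f hf') = S' (mk f hf') := by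
    let M : Submodule ℝ (StrongDual ℝ E → ℝ) :=
      { carrier := {f | ∃ hf' : f ∈ FreeBL.FBL E,
          S (mk f hf') = S' (mk f hf')}
        zero_mem' := ⟨zero_mem _, (map_zero S).trans (map_zero S').symm⟩
        add_mem' := fun {f g} hf hg => by
          obtain ⟨hf, h1⟩ := hf
          obtain ⟨hg, h2⟩ := hg
          refine ⟨add_mem hf hg, ?_⟩
          have e1 := map_add S (mk f hf) (mk g hg)
          have e2 := map_add S' (mk f hf) (mk g hg)
          rw [h1, h2] at e1
          exact e1.trans e2.symm
        smul_mem' := fun c f hf => by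
          obtain ⟨hf, h1⟩ := hf
          refine ⟨Submodule.smul_mem _ c hf, ?_⟩
          have e1 := map_smul S c (mk f hf)
          have e2 := map_smul S' c (mk f hf)
          rw [h1] at e1
          exact e1.trans e2.symm }
    have hM : generated E ≤ M := sInf_le ⟨fun x => ⟨eval_mem_FBL x, h x⟩, by
      rintro f ⟨hf, h1⟩ g ⟨hg, h2⟩
      refine ⟨sup_mem_FBL hf hg, ?_⟩
      have e1 := hS (mk f hf) (mk g hg)
      have e2 := hS' (mk f hf) (mk g hg)
      rw [h1, h2] at e1
      exact e1.trans e2.symm⟩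
    exact fun f hf => hM hf
  refine ContinuousLinearMap.ext fun f => ?_
  have hcl : f ∈ closure {g : FBLRe E | S g = S' g} := by
    refine Metric.mem_closure_iff.2 fun ε hε => ?_
    obtain ⟨g, hg, hfg⟩ := f.2.2 (ENNReal.ofReal (ε / 2)) (by simpa using hε)
    obtain ⟨hg', hgS⟩ := hgen g hg
    let g' : FBLRe E := mk g hg'
    refine ⟨g', hgS, ?_⟩
    rw [dist_eq_norm]
    have h2 := ENNReal.toReal_mono ENNReal.ofReal_ne_top ((cNorm_le (f.1 - g)).trans hfg)
    rw [ENNReal.toReal_ofReal (by positivity)] at h2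
    have h3 : ‖f - g'‖ ≤ ε / 2 := h2
    linarith
  exact (isClosed_eq S.continuous S'.continuous).closure_subset hcl

end Functorial

end FBLRe

section FBLC

variable {E : Type*} [NormedAddCommGroup E] [NormedSpace ℂ E]
variable {G : Type*} [NormedAddCommGroup G] [NormedSpace ℂ G]

/-- The free complex Banach lattice `FBL_ℂ[E]` generated by the complex Banach space `E`. -/
abbrev FBLC (E : Type*) [NormedAddCommGroup E] [NormedSpace ℂ E] : Type _ := Cplx (FBLRe E)

/-- The canonical embedding `δ_E(z) = δ_{E_ℝ}(z) - i δ_{E_ℝ}(iz)`. -/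
noncomputable def deltaC : E →L[ℂ] FBLC E :=
  LinearMap.mkContinuous
    { toFun := fun z => ⟨FBLRe.deltaRe z, -FBLRe.deltaRe (Complex.I • z)⟩
      map_add' := fun z w => by
        ext φ <;> simp [add_comm]
      map_smul' := fun c z => by
        have key : ∀ (φ : StrongDual ℝ E) (d : ℂ) (v : E),
            φ (d • v) = d.re * φ v + d.im * φ (Complex.I • v) := by
          intro φ d v
          have : d • v = d.re • v + d.im • (Complex.I • v) := by
            conv_lhs => rw [← Complex.re_add_im d, add_smul, mul_smul]
            rfl
          rw [this, map_add, map_smul, map_smul, smul_eq_mul, smul_eq_mul]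
        ext φ
        · simp [key φ c z]
        · have : Complex.I • c • z = (Complex.I * c) • z := (mul_smul _ _ _).symm
          simp [this, key φ (Complex.I * c) z]
          ring }
    2 (fun z => by
      refine (Cplx.norm_le_add _).trans ?_
      have h1 := FBLRe.norm_deltaRe_le z
      have h2 := FBLRe.norm_deltaRe_le (Complex.I • z)
      rw [norm_smul, Complex.norm_I, one_mul] at h2
      simp only [LinearMap.coe_mk, AddHom.coe_mk, norm_neg]
      linarith)

theorem deltaC_apply (z : E) :
    deltaC z = ⟨FBLRe.deltaRe z, -FBLRe.deltaRe (Complex.I • z)⟩ := rfl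

theorem existsUnique_inducedHom (T : E →L[ℂ] G) :
    ∃! S : FBLC E →L[ℂ] FBLC G, Cplx.IsLatticeHom S ∧ ∀ z, S (deltaC z) = deltaC (T z) := by
  refine ⟨Cplx.map (FBLRe.compRe T), ⟨⟨_, fun _ _ => rfl, fun _ _ => rfl, rfl⟩, fun z => ?_⟩, ?_⟩
  · rw [deltaC_apply, deltaC_apply, ← map_smul T]
    rfl
  · rintro _ ⟨⟨S, hS, -, rfl⟩, h⟩
    congr 1
    refine FBLRe.hom_ext hS (fun _ _ => rfl) fun x => ?_
    exact congrArg Cplx.re (h x)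

/-- The operator `T̄`: the unique lattice homomorphism `FBL_ℂ[E] → FBL_ℂ[G]` such that
`T̄ ∘ δ_E = δ_G ∘ T`. -/
noncomputable def inducedHom (T : E →L[ℂ] G) : FBLC E →L[ℂ] FBLC G :=
  (existsUnique_inducedHom T).choose

theorem isLatticeHom_inducedHom (T : E →L[ℂ] G) : Cplx.IsLatticeHom (inducedHom T) :=
  (existsUnique_inducedHom T).choose_spec.1.1

theorem inducedHom_deltaC (T : E →L[ℂ] G) (z : E) : inducedHom T (deltaC z) = deltaC (T z) :=
  (existsUnique_inducedHom T).choose_spec.1.2 z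

end FBLC

/-! The embedding `deltaC` intertwines `T` with `inducedHom T`. On its own this gives only half of
what is needed: an inverse of `c - inducedHom T` need not respect the range of `deltaC`. For E =
X_ℂ, however, `deltaC` has a left inverse β that also intertwines the two operators, so T is a
retract of `inducedHom T`. If R inverts `c - inducedHom T`, then β ∘ R ∘ δ inverts `c - T`: being a
left inverse uses the intertwining by δ, being a right inverse uses that by β
(`Cplx.exists_retraction`).

The map β is the complexification of the real lattice homomorphism S : FBL[E_ℝ] → X with S δ_z = Re
z. It satisfies β ∘ δ = id because Re(iz) = -Im z. It intertwines because, for T the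
complexification of R, the lattice homomorphisms S ∘ Q and R ∘ S (Q the real part of `inducedHom T`)
agree on evaluations, with common value Re(Tz) = R(Re z), and evaluations determine a bounded
lattice homomorphism (`FBLRe.latticeHom_ext`).

The substance is the existence of S (`FBLRe.exists_lift`). Its graph is built as the closure of the
sublattice generated by the pairs (δ_z, T z), for a real contraction T : E → X. That this closure is
the graph of a bounded map rests on ‖x‖ ≤ ‖f‖ for every pair (f, x) of the sublattice
(`FBLRe.norm_snd_le_tupleNorm`). To prove it, take a positive φ norming |x| and split it, by
Hahn–Banach, into positive parts adapted to a finite supremum (`exists_sum_eq_map_sup'`). Composing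
the parts with T gives an admissible tuple in the definition of the free norm, and on it the sum ∑
|f(χ_k)| is at least φ(x). -/

/-! ### Supporting functionals of sublinear maps -/

/-- A sublinear functional dominates a linear one that agrees with it at a given point. -/
theorem exists_linearMap_le_eq {V : Type*} [AddCommGroup V] [Module ℝ V] {N : V → ℝ}
    (hsmul : ∀ c : ℝ, 0 < c → ∀ x, N (c • x) = c * N x) (hadd : ∀ x y, N (x + y) ≤ N x + N y)
    (x : V) : ∃ g : V →ₗ[ℝ] ℝ, g x = N x ∧ ∀ y, g y ≤ N y := by
  have hzero : N 0 = 0 := by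
    have h := hsmul 2 two_pos 0
    rw [smul_zero] at h
    linarith
  have hker : ∀ c : ℝ, c • x = 0 → c • N x = 0 := fun c hc => by
    rcases smul_eq_zero.1 hc with rfl | rfl
    · exact zero_smul ℝ _
    · rw [hzero, smul_zero]
  obtain ⟨g, hg, hle⟩ := exists_extension_of_le_sublinear
    (LinearPMap.mkSpanSingleton' (R := ℝ) x (N x) hker) N hsmul hadd (by
      rintro ⟨y, hy⟩
      obtain ⟨c, rfl⟩ := Submodule.mem_span_singleton.1 hy
      rw [LinearPMap.mkSpanSingleton'_apply, RingHom.id_apply, smul_eq_mul]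
      rcases lt_trichotomy c 0 with hc | rfl | hc
      · have h1 := hsmul (-c) (neg_pos.2 hc) x
        have h2 := hadd (c • x) (-c • x)
        rw [← add_smul, add_neg_cancel, zero_smul, hzero, h1] at h2
        simp only
        linarith
      · simp [hzero]
      · exact (hsmul c hc x).ge)
  refine ⟨g, ?_, hle⟩
  have h := hg ⟨x, Submodule.mem_span_singleton_self x⟩
  rw [h]
  exact LinearPMap.mkSpanSingleton'_apply_self x (N x) hker _

/-! ### Sublattices generated by a linear range; splitting a positive functional -/

section VectorLattice

variable {L : Type*} [AddCommGroup L] [Module ℝ L] [Lattice L] [IsOrderedAddMonoid L]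
  [IsOrderedModule ℝ L] {E : Type*} [AddCommGroup E] [Module ℝ E]

/-- Translations are order isomorphisms, so the sum of two finite suprema is the supremum of the
pairwise sums, which lie in the range again. -/
theorem add_mem_supClosure_range (i : E →ₗ[ℝ] L) {a b : L}
    (ha : a ∈ supClosure (Set.range i)) (hb : b ∈ supClosure (Set.range i)) :
    a + b ∈ supClosure (Set.range i) := by
  obtain ⟨s, hs, hsi, rfl⟩ := ha
  obtain ⟨t, ht, hti, rfl⟩ := hb
  have hadd := map_finset_sup' (OrderIso.addRight (t.sup' ht id)) hs id
  rw [OrderIso.addRight_apply] at hadd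
  rw [hadd]
  refine supClosed_supClosure.finsetSup'_mem hs fun x hx => ?_
  have h := map_finset_sup' (OrderIso.addLeft x) ht id
  simp only [Function.comp_apply, OrderIso.addLeft_apply, OrderIso.addRight_apply, id] at h ⊢
  rw [h]
  refine supClosed_supClosure.finsetSup'_mem ht fun y hy => subset_supClosure ?_
  obtain ⟨u, rfl⟩ := hsi hx
  obtain ⟨v, rfl⟩ := hti hy
  exact ⟨u + v, by simp⟩

theorem smul_sup_of_nonneg {c : ℝ} (hc : 0 ≤ c) (a b : L) : c • (a ⊔ b) = c • a ⊔ c • b := by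
  rcases hc.eq_or_lt with rfl | hc
  · simp
  · exact (OrderIso.smulRight hc).map_sup a b

theorem smul_mem_supClosure_range (i : E →ₗ[ℝ] L) {c : ℝ} (hc : 0 ≤ c) {a : L}
    (ha : a ∈ supClosure (Set.range i)) : c • a ∈ supClosure (Set.range i) := by
  have : supClosure (Set.range i) ⊆ (fun x => c • x) ⁻¹' supClosure (Set.range i) := by
    refine supClosure_min ?_ ?_
    · rintro _ ⟨u, rfl⟩
      exact subset_supClosure ⟨c • u, map_smul i c u⟩
    · intro x hx y hy
      rw [Set.mem_preimage, smul_sup_of_nonneg hc]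
      exact supClosed_supClosure hx hy
  exact this ha

/-- The vector sublattice generated by the range of a linear map: the differences of finite
suprema. -/
def sublatticeRange (i : E →ₗ[ℝ] L) : Submodule ℝ L where
  carrier := {x | ∃ a ∈ supClosure (Set.range i), ∃ b ∈ supClosure (Set.range i), x = a - b}
  zero_mem' := ⟨i 0, subset_supClosure ⟨0, rfl⟩, i 0, subset_supClosure ⟨0, rfl⟩, by simp⟩
  add_mem' := by
    rintro _ _ ⟨a, ha, b, hb, rfl⟩ ⟨c, hc, d, hd, rfl⟩
    exact ⟨a + c, add_mem_supClosure_range i ha hc, b + d, add_mem_supClosure_range i hb hd,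
      by abel⟩
  smul_mem' := by
    rintro r _ ⟨a, ha, b, hb, rfl⟩
    rcases le_total 0 r with hr | hr
    · exact ⟨r • a, smul_mem_supClosure_range i hr ha, r • b, smul_mem_supClosure_range i hr hb,
        smul_sub r a b⟩
    · exact ⟨(-r) • b, smul_mem_supClosure_range i (neg_nonneg.2 hr) hb, (-r) • a,
        smul_mem_supClosure_range i (neg_nonneg.2 hr) ha, by module⟩

theorem mem_sublatticeRange (i : E →ₗ[ℝ] L) (u : E) : i u ∈ sublatticeRange i :=
  ⟨i u, subset_supClosure ⟨u, rfl⟩, i 0, subset_supClosure ⟨0, rfl⟩, by simp⟩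

/-- Translating by b + d turns (a - b) ⊔ (c - d) into (a + d) ⊔ (c + b), a supremum of sums of
finite suprema. -/
theorem sup_mem_sublatticeRange (i : E →ₗ[ℝ] L) {x y : L} (hx : x ∈ sublatticeRange i)
    (hy : y ∈ sublatticeRange i) : x ⊔ y ∈ sublatticeRange i := by
  obtain ⟨a, ha, b, hb, rfl⟩ := hx
  obtain ⟨c, hc, d, hd, rfl⟩ := hy
  refine ⟨(a + d) ⊔ (c + b), supClosed_supClosure (add_mem_supClosure_range i ha hd)
    (add_mem_supClosure_range i hc hb), b + d, add_mem_supClosure_range i hb hd, ?_⟩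
  have h := (OrderIso.subRight (b + d)).map_sup (a + d) (c + b)
  simp only [OrderIso.subRight_apply] at h
  rw [h]
  congr 1 <;> abel

theorem abs_mem_sublatticeRange (i : E →ₗ[ℝ] L) {x : L} (hx : x ∈ sublatticeRange i) :
    |x| ∈ sublatticeRange i :=
  sup_mem_sublatticeRange i hx (neg_mem hx)

/-- A positive functional `φ` splits into positive functionals whose values at the `w k` add up
to the value of `φ` at the supremum of the `w k`. -/
theorem exists_sum_eq_map_sup' {ι : Type*} [Fintype ι] [Nonempty ι] (φ : L →ₗ[ℝ] ℝ)
    (hφ : ∀ u, 0 ≤ u → 0 ≤ φ u) (w : ι → L) :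
    ∃ ψ : ι → L →ₗ[ℝ] ℝ, (∀ k u, 0 ≤ u → 0 ≤ ψ k u) ∧ (∀ u, ∑ k, ψ k u = φ u) ∧
      φ (Finset.univ.sup' Finset.univ_nonempty w) = ∑ k, ψ k (w k) := by
  classical
  have hmono : ∀ {u v : L}, u ≤ v → φ u ≤ φ v := fun {u v} h => by
    have := hφ (v - u) (sub_nonneg.2 h)
    rw [map_sub] at this
    linarith
  let S : (ι → L) → L := fun u => Finset.univ.sup' Finset.univ_nonempty u
  have hle : ∀ (u : ι → L) k, u k ≤ S u := fun u k => Finset.le_sup' u (Finset.mem_univ k)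
  have hlub : ∀ (u : ι → L) b, (∀ k, u k ≤ b) → S u ≤ b := fun u b h =>
    Finset.sup'_le _ _ fun k _ => h k
  have hsmul : ∀ c : ℝ, 0 < c → ∀ u : ι → L, φ (S (c • u)) = c * φ (S u) := fun c hc u => by
    rw [← smul_eq_mul, ← map_smul]
    congr 1
    exact (map_finset_sup' (OrderIso.smulRight hc) Finset.univ_nonempty u).symm
  have hadd : ∀ u v : ι → L, φ (S (u + v)) ≤ φ (S u) + φ (S v) := fun u v => by
    rw [← map_add]
    exact hmono (hlub _ _ fun k => add_le_add (hle u k) (hle v k))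
  have hzero : S 0 = 0 := le_antisymm (hlub _ _ fun _ => le_rfl) (hle 0 (Classical.arbitrary ι))
  -- The map u ↦ φ(sup u_k) is sublinear on L^ι. A linear functional supporting it at w has the
  -- required parts as its coordinates.
  obtain ⟨Φ, hΦ, hΦle⟩ : ∃ Φ : (ι → L) →ₗ[ℝ] ℝ, Φ w = φ (S w) ∧ ∀ u, Φ u ≤ φ (S u) :=
    exists_linearMap_le_eq (N := fun u => φ (S u)) hsmul hadd w
  have hsum : ∀ u : ι → L, Φ u = ∑ k, Φ (Pi.single k (u k)) := fun u => by
    rw [← map_sum, Finset.univ_sum_single]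
  refine ⟨fun k => Φ.comp (LinearMap.single ℝ (fun _ => L) k), fun k u hu => ?_, fun u => ?_, ?_⟩
  -- For u ≥ 0 every coordinate of `-Pi.single k u` is at most 0, hence so is the supremum.
  · have h1 := hΦle (-Pi.single k u)
    have h2 : S (-Pi.single k u) ≤ 0 := hlub _ _ fun j => by
      rcases eq_or_ne j k with rfl | hj
      · simpa using hu
      · simp [hj]
    have h3 := hmono h2
    rw [map_zero] at h3
    rw [map_neg] at h1
    simp only [LinearMap.comp_apply, LinearMap.coe_single]
    linarith
  -- On constant tuples the sublinear map is φ itself, thus linear; testing u and -u forces Φ = φ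
  -- there.
  · have h1 : ∀ v : L, S (fun _ => v) = v := fun v =>
      le_antisymm (hlub _ _ fun _ => le_rfl) (hle (fun _ => v) (Classical.arbitrary ι))
    have h2 := hΦle fun _ => u
    have h3 := hΦle (-fun _ => u)
    have h4 : S (-fun _ => u) = -u := h1 (-u)
    rw [h4, map_neg, map_neg] at h3
    rw [h1] at h2
    have h5 := hsum fun _ => u
    simp only [LinearMap.comp_apply, LinearMap.coe_single]
    linarith
  · simp only [LinearMap.comp_apply, LinearMap.coe_single]
    rw [← hsum]
    exact hΦ.symm

end VectorLattice

/-! ### Positive norming functionals -/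

section BanachLattice

variable {X : Type*} [NormedAddCommGroup X] [NormedSpace ℝ X] [Lattice X] [HasSolidNorm X]
  [IsOrderedAddMonoid X] [IsOrderedModule ℝ X]

/-- Hahn–Banach with the sublinear map u ↦ ‖u⁺‖ in place of the norm: it vanishes on negative
elements, which forces positivity, and u⁺ ≤ |u| keeps it below ‖u‖. -/
theorem exists_positive_functional_eq_norm {a : X} (ha : 0 ≤ a) :
    ∃ φ : X →ₗ[ℝ] ℝ, (∀ u, 0 ≤ u → 0 ≤ φ u) ∧ (∀ u, φ u ≤ ‖u‖) ∧ φ a = ‖a‖ := by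
  have hmono : ∀ {u v : X}, 0 ≤ u → u ≤ v → ‖u‖ ≤ ‖v‖ := fun {u v} hu h =>
    norm_le_norm_of_abs_le_abs (by rwa [abs_of_nonneg hu, abs_of_nonneg (hu.trans h)])
  have hsmul : ∀ c : ℝ, 0 < c → ∀ u : X, ‖(c • u)⁺‖ = c * ‖u⁺‖ := fun c hc u => by
    have : (c • u)⁺ = c • u⁺ := by
      rw [posPart_def, posPart_def, smul_sup_of_nonneg hc.le, smul_zero]
    rw [this, norm_smul, Real.norm_of_nonneg hc.le]
  have hadd : ∀ u v : X, ‖(u + v)⁺‖ ≤ ‖u⁺‖ + ‖v⁺‖ := fun u v =>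
    (hmono (posPart_nonneg _) (sup_le (add_le_add (le_posPart u) (le_posPart v))
      (add_nonneg (posPart_nonneg u) (posPart_nonneg v)))).trans (norm_add_le _ _)
  obtain ⟨φ, hφa, hφ⟩ : ∃ φ : X →ₗ[ℝ] ℝ, φ a = ‖a‖ ∧ ∀ u, φ u ≤ ‖u⁺‖ := by
    obtain ⟨φ, hφa, hφ⟩ := exists_linearMap_le_eq (N := fun u : X => ‖u⁺‖) hsmul hadd a
    exact ⟨φ, by rw [hφa, posPart_of_nonneg ha], hφ⟩
  refine ⟨φ, fun u hu => ?_, fun u => (hφ u).trans ?_, hφa⟩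
  · have h := hφ (-u)
    rw [posPart_of_nonpos (neg_nonpos.2 hu), norm_zero, map_neg] at h
    linarith
  · exact norm_le_norm_of_abs_le_abs (by
      rw [abs_of_nonneg (posPart_nonneg u)]
      exact sup_le (le_abs_self u) (abs_nonneg u))

end BanachLattice

/-! ### Universal property of the real free Banach lattice -/

namespace FBLRe

open FreeBL

variable {X : Type*} [NormedAddCommGroup X] [NormedSpace ℝ X] [Lattice X] [HasSolidNorm X]
  [IsOrderedAddMonoid X] [IsOrderedModule ℝ X]
variable {E : Type*} [NormedAddCommGroup E] [NormedSpace ℂ E]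

instance : IsOrderedModule ℝ ((StrongDual ℝ E → ℝ) × X) where
  smul_le_smul_of_nonneg_left _ hc _ _ h :=
    ⟨fun φ => mul_le_mul_of_nonneg_left (h.1 φ) hc, smul_le_smul_of_nonneg_left h.2 hc⟩
  smul_le_smul_of_nonneg_right _ hp _ _ h :=
    ⟨fun φ => mul_le_mul_of_nonneg_right h (hp.1 φ), smul_le_smul_of_nonneg_right h hp.2⟩

/-- The map `z ↦ (δ_z, T z)`. -/
noncomputable def evalProd (T : E →L[ℝ] X) : E →ₗ[ℝ] (StrongDual ℝ E → ℝ) × X where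
  toFun z := (eval z, T z)
  map_add' z w := by ext <;> simp [eval]
  map_smul' c z := by ext <;> simp [eval]

/-- Write p = A - b with A = sup_k (δ_{z_k}, T z_k), and split φ into positive ψ_k with φ(sup T z_k)
= ∑ ψ_k(T z_k). With χ_k = ψ_k ∘ T, the first component of A at χ_k is at least ψ_k(T z_k), and that
of b is at most ψ_k(b.2). Summing bounds φ(p.2) by ∑ |p.1(χ_k)|. -/
theorem apply_sub_le_tupleNorm {T : E →L[ℝ] X} (hT : ∀ z, ‖T z‖ ≤ ‖z‖) {φ : X →ₗ[ℝ] ℝ}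
    (hφ : ∀ u, 0 ≤ u → 0 ≤ φ u) (hφn : ∀ u, φ u ≤ ‖u‖) {p : (StrongDual ℝ E → ℝ) × X}
    (hp : p ∈ sublatticeRange (evalProd T)) :
    ENNReal.ofReal (φ p.2) ≤ tupleNorm (weakUnit ℝ E) p.1 := by
  obtain ⟨_, ⟨s, hs, hsT, rfl⟩, b, hb, rfl⟩ := hp
  obtain ⟨n, ⟨e⟩⟩ : ∃ n, Nonempty (s ≃ Fin n) := ⟨_, ⟨s.equivFin⟩⟩
  have : Nonempty (Fin n) := hs.coe_sort.map e
  choose z hz using fun k : Fin n => hsT (e.symm k).2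
  have hsup : s.sup' hs id =
      Finset.univ.sup' Finset.univ_nonempty fun k : Fin n => evalProd T (z k) := by
    refine le_antisymm (Finset.sup'_le _ _ fun x hx => ?_) (Finset.sup'_le _ _ fun k _ => ?_)
    · refine le_trans (le_of_eq ?_) (Finset.le_sup' _ (Finset.mem_univ (e ⟨x, hx⟩)))
      rw [hz]
      simp
    · rw [hz]
      exact Finset.le_sup' id (e.symm k).2
  rw [hsup]
  obtain ⟨ψ, hψ, hψs, hψw⟩ := exists_sum_eq_map_sup' φ hφ fun k => T (z k)
  have habs : ∀ k u, |ψ k u| ≤ ψ k |u| := fun k u => by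
    have h1 := hψ k (|u| - u) (sub_nonneg.2 (le_abs_self u))
    have h2 := hψ k (|u| - -u) (sub_nonneg.2 (neg_le_abs u))
    rw [map_sub] at h1 h2
    rw [map_neg] at h2
    exact abs_le'.2 ⟨by linarith, by linarith⟩
  -- Positivity of the parts yields ∑ |ψ_k u| ≤ ∑ ψ_k |u| = φ |u| ≤ ‖u‖. This makes each ψ_k
  -- continuous and, as T is a contraction, puts the tuple χ in `weakUnit`.
  have hsumabs : ∀ u, ∑ k, |ψ k u| ≤ ‖u‖ := fun u => by
    refine (Finset.sum_le_sum fun k _ => habs k u).trans ?_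
    rw [hψs, ← norm_abs_eq_norm u]
    exact hφn _
  let χ : Fin n → StrongDual ℝ E := fun k =>
    ((ψ k).mkContinuous 1 fun u => by
      rw [one_mul]
      exact (Finset.single_le_sum (f := fun k => |ψ k u|) (fun _ _ => abs_nonneg _)
        (Finset.mem_univ k)).trans (hsumabs u)).comp T
  have hχ : ∀ k v, χ k v = ψ k (T v) := fun _ _ => rfl
  have hmem : (⟨n, χ⟩ : Σ n : ℕ, Fin n → StrongDual ℝ E) ∈ weakUnit ℝ E := fun v hv =>
    (hsumabs (T v)).trans ((hT v).trans hv)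
  refine le_trans (ENNReal.ofReal_le_ofReal ?_) (le_tupleNorm hmem _)
  -- Equality holds on evaluations; a supremum preserves only the inequality, since ψ_k is monotone
  -- but not a lattice homomorphism. It is the direction needed for the subtracted term.
  have hbψ : ∀ k, b.1 (χ k) ≤ ψ k b.2 := by
    have : supClosure (Set.range (evalProd T)) ⊆
        {b : (StrongDual ℝ E → ℝ) × X | ∀ k, b.1 (χ k) ≤ ψ k b.2} := by
      refine supClosure_min ?_ ?_
      · rintro _ ⟨u, rfl⟩ k
        exact (hχ k u).le
      · intro x hx y hy k
        have hmono : ∀ {u v : X}, u ≤ v → ψ k u ≤ ψ k v := fun {u v} h => by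
          have := hψ k (v - u) (sub_nonneg.2 h)
          rw [map_sub] at this
          linarith
        exact max_le ((hx k).trans (hmono le_sup_left)) ((hy k).trans (hmono le_sup_right))
    exact this hb
  set A := Finset.univ.sup' Finset.univ_nonempty fun k : Fin n => evalProd T (z k) with hA
  have hA2 : A.2 = Finset.univ.sup' Finset.univ_nonempty fun k => T (z k) := by
    refine le_antisymm ?_ (Finset.sup'_le _ _ fun k _ => ?_)
    · have : A ≤ (A.1, Finset.univ.sup' Finset.univ_nonempty fun k => T (z k)) :=
        Finset.sup'_le _ _ fun k _ =>
          ⟨(Finset.le_sup' (fun k => evalProd T (z k)) (Finset.mem_univ k)).1,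
            Finset.le_sup' (fun k => T (z k)) (Finset.mem_univ k)⟩
      exact this.2
    · exact (Finset.le_sup' (fun k => evalProd T (z k)) (Finset.mem_univ k)).2
  have hA1 : ∀ k, ψ k (T (z k)) ≤ A.1 (χ k) := fun k =>
    (Finset.le_sup' (fun k => evalProd T (z k)) (Finset.mem_univ k)).1 (χ k)
  change φ (A.2 - b.2) ≤ ∑ j, |A.1 (χ j) - b.1 (χ j)|
  rw [map_sub, hA2, hψw, ← hψs, ← Finset.sum_sub_distrib]
  exact Finset.sum_le_sum fun k _ =>
    (sub_le_sub (hA1 k) (hbψ k)).trans (le_abs_self _)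

/-- The sublattice contains |p|, whose first component has the same free norm as that of p; a
positive functional norming |p.2| then gives the bound. -/
theorem norm_snd_le_tupleNorm {T : E →L[ℝ] X} (hT : ∀ z, ‖T z‖ ≤ ‖z‖)
    {p : (StrongDual ℝ E → ℝ) × X} (hp : p ∈ sublatticeRange (evalProd T)) :
    ENNReal.ofReal ‖p.2‖ ≤ tupleNorm (weakUnit ℝ E) p.1 := by
  obtain ⟨φ, hφ, hφn, hφa⟩ := exists_positive_functional_eq_norm (abs_nonneg p.2)
  have h := apply_sub_le_tupleNorm hT hφ hφn (abs_mem_sublatticeRange _ hp)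
  have h2 : |p|.2 = |p.2| := rfl
  rw [h2, hφa, norm_abs_eq_norm] at h
  exact h.trans (tupleNorm_mono fun w => (abs_abs (p.1 w)).le)

/-- The graph of the lattice homomorphism extending `T` to the sublattice generated by the
evaluations. -/
def liftGraph (T : E →L[ℝ] X) : Submodule ℝ (FBLRe E × X) where
  carrier := {p | (p.1.1, p.2) ∈ sublatticeRange (evalProd T)}
  zero_mem' := zero_mem (sublatticeRange (evalProd T))
  add_mem' := fun hp hq => (sublatticeRange (evalProd T)).add_mem hp hq
  smul_mem' := fun c _ hp => (sublatticeRange (evalProd T)).smul_mem c hp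

theorem mem_liftGraph {T : E →L[ℝ] X} {p : FBLRe E × X} :
    p ∈ liftGraph T ↔ (p.1.1, p.2) ∈ sublatticeRange (evalProd T) := Iff.rfl

theorem sup_mem_liftGraph (T : E →L[ℝ] X) {p q : FBLRe E × X} (hp : p ∈ liftGraph T)
    (hq : q ∈ liftGraph T) : p ⊔ q ∈ liftGraph T :=
  mem_liftGraph.2 (sup_mem_sublatticeRange (evalProd T)
    (mem_liftGraph.1 hp) (mem_liftGraph.1 hq))

/-- Makes the closure the graph of a bounded function: a pair with first entry 0 has second entry 0.
The 2 is the price of passing from the real free norm to the norm `cNorm`. -/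
theorem norm_snd_le_of_mem_closure {T : E →L[ℝ] X} (hT : ∀ z, ‖T z‖ ≤ ‖z‖) {p : FBLRe E × X}
    (hp : p ∈ (liftGraph T).topologicalClosure) : ‖p.2‖ ≤ 2 * ‖p.1‖ := by
  have hcl : IsClosed {p : FBLRe E × X | ‖p.2‖ ≤ 2 * ‖p.1‖} :=
    isClosed_le (by fun_prop) (by fun_prop)
  refine closure_minimal (fun q hq => ?_) hcl hp
  have h := (norm_snd_le_tupleNorm hT (mem_liftGraph.1 hq)).trans (le_cNorm (f := q.1.1) q.1.2.1.1)
  have h2 := ENNReal.toReal_mono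
    (ENNReal.mul_lt_top ENNReal.ofNat_lt_top (cNorm_lt_top q.1)).ne h
  rw [ENNReal.toReal_ofReal (norm_nonneg _), ENNReal.toReal_mul, ENNReal.toReal_ofNat] at h2
  exact h2

theorem sup_mem_closure_liftGraph (T : E →L[ℝ] X) {p q : FBLRe E × X}
    (hp : p ∈ (liftGraph T).topologicalClosure) (hq : q ∈ (liftGraph T).topologicalClosure) :
    p ⊔ q ∈ (liftGraph T).topologicalClosure :=
  map_mem_closure₂ (f := fun p q : FBLRe E × X => p ⊔ q) 
    (((continuous_fst.comp continuous_fst).sup (continuous_fst.comp continuous_snd)).prodMk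
      ((continuous_snd.comp continuous_fst).sup (continuous_snd.comp continuous_snd))) hp hq
    fun _ ha _ hb => sup_mem_liftGraph T ha hb

/-- The first-coordinate projection of the sublattice is itself a sublattice containing all
evaluations, so minimality of `generated` applies. -/
theorem exists_mem_liftGraph (T : E →L[ℝ] X) {f : StrongDual ℝ E → ℝ} (hf : f ∈ generated E) :
    ∃ x, (mk f (generated_le hf), x) ∈ liftGraph T := by
  have h : generated E ≤ (sublatticeRange (evalProd T)).map
      (LinearMap.fst ℝ (StrongDual ℝ E → ℝ) X) := by
    refine sInf_le ⟨fun z => ⟨_, mem_sublatticeRange (evalProd T) z, rfl⟩, ?_⟩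
    rintro _ ⟨p, hp, rfl⟩ _ ⟨q, hq, rfl⟩
    exact ⟨p ⊔ q, sup_mem_sublatticeRange _ hp hq, rfl⟩
  obtain ⟨⟨_, x⟩, hp, rfl⟩ := h hf
  exact ⟨x, mem_liftGraph.2 hp⟩

variable [CompleteSpace X]

/-- Approximate f by generated elements; the norm bound applied to differences makes their second
entries Cauchy, and X is complete. -/
theorem exists_mem_closure_liftGraph {T : E →L[ℝ] X} (hT : ∀ z, ‖T z‖ ≤ ‖z‖) (f : FBLRe E) :
    ∃ x, (f, x) ∈ (liftGraph T).topologicalClosure := by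
  have happrox : ∀ n : ℕ, ∃ p ∈ liftGraph T, ‖p.1 - f‖ ≤ 1 / ((n : ℝ) + 1) := fun n => by
    have hn : (0 : ℝ) < 1 / ((n : ℝ) + 1) := by positivity
    obtain ⟨g, hg, hfg⟩ := f.2.2 (ENNReal.ofReal (1 / ((n : ℝ) + 1))) (by simpa using hn)
    obtain ⟨x, hx⟩ := exists_mem_liftGraph T hg
    refine ⟨_, hx, ?_⟩
    have h := ENNReal.toReal_mono ENNReal.ofReal_ne_top ((cNorm_le (f.1 - g)).trans hfg)
    rw [ENNReal.toReal_ofReal hn.le] at h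
    rw [norm_sub_rev]
    exact h
  choose p hp hpf using happrox
  have hlim : Tendsto (fun n => (p n).1) atTop (𝓝 f) :=
    tendsto_iff_norm_sub_tendsto_zero.2
      (squeeze_zero (fun _ => norm_nonneg _) hpf tendsto_one_div_add_atTop_nhds_zero_nat)
  have hcau : CauchySeq fun n => (p n).2 := by
    have h1 := Metric.cauchySeq_iff.1 hlim.cauchySeq
    refine Metric.cauchySeq_iff.2 fun ε hε => ?_
    obtain ⟨N, hN⟩ := h1 (ε / 2) (by positivity)
    refine ⟨N, fun m hm n hn => ?_⟩
    have h2 := hN m hm n hn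
    have h3 := norm_snd_le_of_mem_closure hT
      ((liftGraph T).le_topologicalClosure (sub_mem (hp m) (hp n)))
    rw [dist_eq_norm] at h2 ⊢
    rw [Prod.fst_sub, Prod.snd_sub] at h3
    linarith
  obtain ⟨x, hx⟩ := cauchySeq_tendsto_of_complete hcau
  exact ⟨x, mem_closure_of_tendsto (hlim.prodMk_nhds hx) (Eventually.of_forall hp)⟩

/-- The universal property of the free Banach lattice, for contractions. -/
theorem exists_lift {T : E →L[ℝ] X} (hT : ∀ z, ‖T z‖ ≤ ‖z‖) :
    ∃ S : FBLRe E →L[ℝ] X, (∀ f g, S (f ⊔ g) = S f ⊔ S g) ∧ (∀ f g, S (f ⊓ g) = S f ⊓ S g) ∧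
      ∀ z, S (deltaRe z) = T z := by
  choose S hS using exists_mem_closure_liftGraph hT
  -- Every algebraic property of S follows from this uniqueness, because the closed graph is both a
  -- subspace and closed under suprema.
  have huniq : ∀ f x, (f, x) ∈ (liftGraph T).topologicalClosure → S f = x := fun f x hx => by
    have h := norm_snd_le_of_mem_closure hT (sub_mem (hS f) hx)
    rw [Prod.fst_sub, Prod.snd_sub, sub_self, norm_zero, mul_zero] at h
    exact sub_eq_zero.1 (norm_le_zero_iff.1 h)
  have hsup : ∀ f g, S (f ⊔ g) = S f ⊔ S g := fun f g =>
    huniq _ _ (sup_mem_closure_liftGraph T (hS f) (hS g))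
  have hneg : ∀ f, S (-f) = -S f := fun f => huniq _ _ (neg_mem (hS f))
  refine ⟨LinearMap.mkContinuous
    { toFun := S
      map_add' := fun f g => huniq _ _ (add_mem (hS f) (hS g))
      map_smul' := fun c f => huniq _ _ (Submodule.smul_mem _ c (hS f)) }
    2 fun f => norm_snd_le_of_mem_closure hT (hS f), hsup, fun f g => ?_, fun z => ?_⟩
  · change S (f ⊓ g) = S f ⊓ S g
    rw [← neg_inj, ← hneg, neg_inf, neg_inf, hsup, hneg, hneg]
  · exact huniq _ _ ((liftGraph T).le_topologicalClosure
      (mem_liftGraph.2 (mem_sublatticeRange (evalProd T) z)))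

/-- Bounded lattice homomorphisms on `FBL[E_ℝ]` with values in any Banach lattice are determined by
their values on evaluations. -/
theorem latticeHom_ext {S S' : FBLRe E →L[ℝ] X} (hS : ∀ f g, S (f ⊔ g) = S f ⊔ S g)
    (hS' : ∀ f g, S' (f ⊔ g) = S' f ⊔ S' g) (h : ∀ z, S (deltaRe z) = S' (deltaRe z)) :
    S = S' := by
  -- The equality locus, viewed among all functions on E*, so that minimality of `generated` can be
  -- used.
  let M : Submodule ℝ (StrongDual ℝ E → ℝ) :=
    (LinearMap.eqLocus S.toLinearMap S'.toLinearMap).map (FreeBL.FBL E).subtype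
  have hM : generated E ≤ M := by
    refine sInf_le ⟨fun z => ⟨deltaRe z, h z, rfl⟩, ?_⟩
    rintro _ ⟨f, hf, rfl⟩ _ ⟨g, hg, rfl⟩
    have hf' : S f = S' f := hf
    have hg' : S g = S' g := hg
    let f' : FBLRe E := f
    let g' : FBLRe E := g
    refine ⟨(f' ⊔ g' : FBLRe E), ?_, rfl⟩
    change S (f' ⊔ g') = S' (f' ⊔ g')
    rw [hS, hS', hf', hg']
  refine ContinuousLinearMap.ext fun f => ?_
  -- Generated elements are dense for the real free norm, which dominates the norm `cNorm` of `FBLRe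
  -- E`.
  have hcl : f ∈ closure {g : FBLRe E | S g = S' g} := by
    refine Metric.mem_closure_iff.2 fun ε hε => ?_
    obtain ⟨g, hg, hfg⟩ := f.2.2 (ENNReal.ofReal (ε / 2)) (by simpa using hε)
    obtain ⟨k, hk, rfl⟩ := hM hg
    let g' : FBLRe E := k
    refine ⟨g', hk, ?_⟩
    rw [dist_eq_norm]
    have h2 := ENNReal.toReal_mono ENNReal.ofReal_ne_top ((cNorm_le _).trans hfg)
    rw [ENNReal.toReal_ofReal (by positivity)] at h2
    have h3 : ‖f - g'‖ ≤ ε / 2 := h2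
    linarith
  exact (isClosed_eq S.continuous S'.continuous).closure_subset hcl

end FBLRe

/-! ### The retraction of the free lattice onto X_ℂ -/

namespace Cplx

variable {X : Type*} [NormedAddCommGroup X] [NormedSpace ℝ X] [Lattice X] [HasSolidNorm X]
  [IsOrderedAddMonoid X] [IsOrderedModule ℝ X] [CompleteSpace X]

/-- The real part as a bounded real-linear map. -/
noncomputable def reCLM : Cplx X →L[ℝ] X :=
  LinearMap.mkContinuous
    { toFun := re
      map_add' := fun _ _ => rfl
      map_smul' := fun c z => by
        have h : ((c : ℂ) • z).re = c • z.re := by rw [smul_re]; simp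
        exact h }
    1 fun z => by
      rw [one_mul]
      exact norm_re_le z

theorem reCLM_apply (z : Cplx X) : reCLM z = z.re := rfl

/-- The free complex Banach lattice over `X_ℂ` projects onto `X_ℂ`, and every lattice homomorphism
of `X_ℂ` is intertwined with the induced one. -/
theorem exists_retraction : ∃ β : FBLC (Cplx X) →L[ℂ] Cplx X, (∀ z, β (deltaC z) = z) ∧
    ∀ T : Cplx X →L[ℂ] Cplx X, IsLatticeHom T → ∀ f, β (inducedHom T f) = T (β f) := by
  obtain ⟨S, hsup, -, hδ⟩ := FBLRe.exists_lift (T := reCLM (X := X)) norm_re_le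
  refine ⟨map S, fun z => ?_, ?_⟩
  -- The second coordinate is -Re(iz), that is, Im z.
  · rw [deltaC_apply, map_apply, map_neg, hδ, hδ, reCLM_apply, reCLM_apply]
    ext <;> simp
  · rintro T ⟨R, hR, -, rfl⟩ f
    obtain ⟨Q, hQ, -, hQT⟩ := isLatticeHom_inducedHom (map R)
    -- The hypothesis on T enters here: R preserves suprema, so both composites do, and at δ_z both
    -- equal R(Re z).
    have hcomp : S.comp Q = R.comp S := by
      refine FBLRe.latticeHom_ext (fun f g => ?_) (fun f g => ?_) fun z => ?_
      · simp only [ContinuousLinearMap.comp_apply, hQ, hsup]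
      · simp only [ContinuousLinearMap.comp_apply, hR, hsup]
      · have h := inducedHom_deltaC (map R) z
        rw [hQT] at h
        have h1 : Q (FBLRe.deltaRe z) = FBLRe.deltaRe (map R z) := congrArg re h
        simp only [ContinuousLinearMap.comp_apply, h1, hδ]
        rfl
    rw [hQT]
    ext
    · exact congrArg (fun U : FBLRe (Cplx X) →L[ℝ] X => U f.re) hcomp
    · exact congrArg (fun U : FBLRe (Cplx X) →L[ℝ] X => U f.im) hcomp

end Cplx

/-! ### Transfer of invertibility -/

theorem propositionp {X : Type*} [NormedAddCommGroup X] [NormedSpace ℝ X] [Lattice X]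
    [HasSolidNorm X] [IsOrderedAddMonoid X] [IsOrderedModule ℝ X] [CompleteSpace X]
    (T : Cplx X →L[ℂ] Cplx X) (hT : Cplx.IsLatticeHom T) :
    spectrum ℂ T ⊆ spectrum ℂ (inducedHom T) := by
  intro c hc hinv
  refine hc ?_
  obtain ⟨β, hβδ, hβ⟩ := Cplx.exists_retraction (X := X)
  obtain ⟨⟨A, R, hAR, hRA⟩, rfl : A = _⟩ := hinv
  have hδ : ∀ z, (algebraMap ℂ (FBLC (Cplx X) →L[ℂ] FBLC (Cplx X)) c - inducedHom T) (deltaC z) =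
      deltaC ((algebraMap ℂ (Cplx X →L[ℂ] Cplx X) c - T) z) := fun z => by
    simp [Algebra.algebraMap_eq_smul_one, inducedHom_deltaC]
  have hβ' : ∀ f, β ((algebraMap ℂ (FBLC (Cplx X) →L[ℂ] FBLC (Cplx X)) c - inducedHom T) f) =
      (algebraMap ℂ (Cplx X →L[ℂ] Cplx X) c - T) (β f) := fun f => by
    simp [Algebra.algebraMap_eq_smul_one, hβ T hT]
  have hAR' := fun f => congrArg (fun U : FBLC (Cplx X) →L[ℂ] FBLC (Cplx X) => U f) hAR
  have hRA' := fun f => congrArg (fun U : FBLC (Cplx X) →L[ℂ] FBLC (Cplx X) => U f) hRA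
  -- The candidate inverse compresses R by δ and β. The right-inverse identity moves `c - T` past β,
  -- the left-inverse identity moves it past δ; both end with β ∘ δ = id.
  refine ⟨⟨algebraMap ℂ (Cplx X →L[ℂ] Cplx X) c - T, β.comp (R.comp deltaC), ?_, ?_⟩, rfl⟩
  · refine ContinuousLinearMap.ext fun z => ?_
    change (algebraMap ℂ (Cplx X →L[ℂ] Cplx X) c - T) (β (R (deltaC z))) = z
    rw [← hβ']
    exact (congrArg β (hAR' (deltaC z))).trans (hβδ z)
  · refine ContinuousLinearMap.ext fun z => ?_
    change β (R (deltaC ((algebraMap ℂ (Cplx X →L[ℂ] Cplx X) c - T) z))) = z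
    rw [← hδ]
    exact (congrArg β (hRA' (deltaC z))).trans (hβδ z)
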